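/- Let $0<q<1$ and $\zeta=q^{-1/2}$. Let $H=\mathcal A[\mathrm{SU}_q(2)]$ be the bialgebra generated by $a=a_1{}^1,\ b=a_1{}^2,\ c=a_2{}^1,\ d=a_2{}^2$ with $ab=qba$, $ac=qca$, $bd=qdb$, $cd=qdc$, $bc=cb$, $ad-da=(q-q^{-1})bc$, $ad-qbc=1$ and $\Delta(a_i{}^j)=a_i{}^\mu\otimes a_\mu{}^j$ (sum over repeated indices), with antipode $S$, and let $\widetilde H=\mathcal A[\mathrm{SU}^{\mathrm{cop}}_q(2)]$ be the same algebra with the opposite coproduct and antipode $\widetilde S=S^{-1}$. The fundamental comodules are $V_{1/2}$, with basis $x_1=x$, $x_2=y$ and $x_k\mapsto x_m\otimes a_m{}^k$, and $\widetilde V_{1/2}$, with basis $\tilde x_1=\tilde x$, $\tilde x_2=\tilde y$ and $\tilde x_k\mapsto\tilde x_m\otimes\widetilde S(a_m{}^k)$. For $n\ge 0$ let $V_{n/2}$ (resp. $\widetilde V_{n/2}$) be the comodule of homogeneous polynomials of degree $n$ in $x,y$ with $xy=q\,yx$ (resp. in $\tilde x,\tilde y$ with $\tilde x\tilde y=q^{-1}\tilde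 y\tilde x$), with the coaction extended multiplicatively. Let $\Psi$ be the braiding of $V_{1/2}\otimes V_{1/2}$: $\Psi(x\otimes x)=q^{1/2}x\otimes x$, $\Psi(x\otimes y)=q^{-1/2}(y\otimes x+(q-q^{-1})x\otimes y)$, $\Psi(y\otimes x)=q^{-1/2}x\otimes y$, $\Psi(y\otimes y)=q^{1/2}y\otimes y$. Let $\widetilde\Psi$ be the corresponding braiding of $\widetilde V_{1/2}\otimes\widetilde V_{1/2}$: $\widetilde\Psi(\tilde x\otimes\tilde x)=q^{1/2}\tilde x\otimes\tilde x$, $\widetilde\Psi(\tilde x\otimes\tilde y)=q^{-1/2}\tilde y\otimes\tilde x$, $\widetilde\Psi(\tilde y\otimes\tilde x)=q^{-1/2}(\tilde x\otimes\tilde y+(q-q^{-1})\tilde y\otimes\tilde x)$, $\widetilde\Psi(\tilde y\otimes\tilde y)=q^{1/2}\tilde y\otimes\tilde y$. Put $V=\widetilde V_{1/2}\otimes V_{1/2}$, a right $\widetilde H\otimes H$-comodule, and let $\Phi=(\mathrm{id}\otimes\sigma\otimes\mathrm{id})(\widetilde\Psi\otimes\Psi)(\mathrm{id}\otimes\sigma\otimes\mathrm{id})$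 on $V\otimes V$, where $\sigma$ is the flip. Let $V^{\wedge2}\subset V\otimes V$ be the subcomodule of $q$-antisymmetric tensors, the eigenspace of $\Phi$ for the eigenvalue $-q^{-1}$. For a right $\widetilde H\otimes H$-comodule algebra $P$ with subalgebra of coinvariants $M=P^{\widetilde H\otimes H}$ and a comodule $X$ let $\mathcal M(X)=(P\otimes X)^{\widetilde H\otimes H}$, an $M$-bimodule by multiplication on $P$. Let $\mathcal A[\mathrm{Sp}_q(2)]$ be the $*$-algebra generated by the entries of $$A=\begin{pmatrix}\mathbf a&\mathbf b\\ \mathbf c&\mathbf d\end{pmatrix},$$ where each block $\mathbf m=(\mathrm m_i{}^j)$ is of the form $$\mathbf m=\begin{pmatrix}m_1&-qm_2^*\\ m_2&m_1^*\end{pmatrix}.$$ Let $R_i{}^j{}_k{}^l$ be the matrix with $R_1{}^1{}_1{}^1=R_2{}^2{}_2{}^2=q$, $R_1{}^1{}_2{}^2=R_2{}^2{}_1{}^1=1$, $R_2{}^1{}_1{}^2=q-q^{-1}$ and all other entries $0$. The $*$-ideal of relations is generated by the following, for all values of the free indices: * $R_i{}^\alpha{}_k{}^\beta\,\mathrm m_\alpha{}^j\mathrm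 m_\beta{}^l=\mathrm m_k{}^\beta\mathrm m_i{}^\alpha R_\alpha{}^j{}_\beta{}^l$ for each block $\mathbf m=\mathbf a,\mathbf b,\mathbf c,\mathbf d$; * $\mathrm b_i{}^1\mathrm a_k{}^j=\zeta R_k{}^\alpha{}_i{}^\beta\mathrm a_\alpha{}^j\mathrm b_\beta{}^1$, $\ \mathrm a_i{}^j\mathrm b_k{}^2=\zeta R_k{}^\alpha{}_i{}^\beta\mathrm b_\alpha{}^2\mathrm a_\beta{}^j$, $\ \mathrm d_i{}^1\mathrm c_k{}^j=\zeta R_k{}^\alpha{}_i{}^\beta\mathrm c_\alpha{}^j\mathrm d_\beta{}^1$, $\ \mathrm c_i{}^j\mathrm d_k{}^2=\zeta R_k{}^\alpha{}_i{}^\beta\mathrm d_\alpha{}^2\mathrm c_\beta{}^j$; * $\mathrm a_1{}^i\mathrm c_m{}^k=\zeta\mathrm c_m{}^\beta\mathrm a_1{}^\alpha R_\alpha{}^i{}_\beta{}^k$, $\ \mathrm c_m{}^i\mathrm a_2{}^k=\zeta\mathrm a_2{}^\beta\mathrm c_m{}^\alpha R_\alpha{}^i{}_\beta{}^k$, $\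 \mathrm b_1{}^i\mathrm d_m{}^k=\zeta\mathrm d_m{}^\beta\mathrm b_1{}^\alpha R_\alpha{}^i{}_\beta{}^k$, $\ \mathrm d_m{}^i\mathrm b_2{}^k=\zeta\mathrm b_2{}^\beta\mathrm d_m{}^\alpha R_\alpha{}^i{}_\beta{}^k$; * $\mathrm c_1{}^j\mathrm b_i{}^1=\zeta^2\mathrm b_i{}^1\mathrm c_1{}^j$, $\ \mathrm c_2{}^j\mathrm b_i{}^2=\zeta^{-2}\mathrm b_i{}^2\mathrm c_2{}^j$, $\ \mathrm d_1{}^2\mathrm a_i{}^j=\zeta^2\mathrm a_i{}^j\mathrm d_1{}^2$, $\ \mathrm d_2{}^1\mathrm a_i{}^j=\zeta^{-2}\mathrm a_i{}^j\mathrm d_2{}^1$; * $\mathrm d_1{}^1\mathrm a_i{}^j-\mathrm a_i{}^j\mathrm d_1{}^1=\zeta(q-q^{-1})\mathrm b_i{}^1\mathrm c_1{}^j$, $\ \mathrm a_i{}^j\mathrm d_2{}^2-\mathrm d_2{}^2\mathrm a_i{}^j=\zeta(q-q^{-1})\mathrm c_2{}^j\mathrm b_i{}^2$, $\ \mathrm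 c_1{}^j\mathrm b_i{}^2-\mathrm b_i{}^2\mathrm c_1{}^j=\zeta(q-q^{-1})\mathrm a_i{}^j\mathrm d_1{}^2$, $\ \mathrm c_2{}^j\mathrm b_i{}^1-\mathrm b_i{}^1\mathrm c_2{}^j=\zeta(q-q^{-1})\mathrm d_2{}^1\mathrm a_i{}^j$; * $\sum_\mu(A_\mu{}^j)^*A_\mu{}^l=\delta_{jl}$ and $\sum_\mu A_j{}^\mu(A_l{}^\mu)^*=\delta_{jl}$. The coaction of $\widetilde H\otimes H$ is given on generators by $\mathrm a_i{}^j\mapsto\mathrm a_\mu{}^j\otimes a_i{}^\mu\otimes1$, $\mathrm b_i{}^j\mapsto\mathrm b_\mu{}^j\otimes a_i{}^\mu\otimes1$, $\mathrm c_i{}^j\mapsto\mathrm c_\mu{}^j\otimes1\otimes S(u_i{}^\mu)$, $\mathrm d_i{}^j\mapsto\mathrm d_\mu{}^j\otimes1\otimes S(u_i{}^\mu)$, where $$(u_i{}^j)=\begin{pmatrix}d&-c\\-b&a\end{pmatrix},$$ and is extended multiplicatively to polynomials in the generators (the free algebra $F$ on the sixteen entries of $A$, an $\widetilde H\otimes H$-comodule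 algebra). The coinvariant elements of $\mathcal A[\mathrm{Sp}_q(2)]$, forming $\mathcal A[S^4_q]$, and of $\mathcal A[\mathrm{Sp}_q(2)]\otimes X$, forming $\mathcal M(X)$, are the images of the coinvariant elements of $F$ and $F\otimes X$. Define $$\Omega^2S^4_q=\mathcal M(V^{\wedge2}),\qquad \Omega^2_+S^4_q=\mathcal M(\widetilde V_1\otimes V_0),\qquad \Omega^2_-S^4_q=\mathcal M(\widetilde V_0\otimes V_1).$$ Then $\dim V^{\wedge2}=6$, and there are maps of $\widetilde H\otimes H$-comodules $\theta_+:V^{\wedge2}\to\widetilde V_1\otimes V_0$ and $\theta_-:V^{\wedge2}\to\widetilde V_0\otimes V_1$ such that: 1. $(\theta_+,\theta_-):V^{\wedge2}\to(\widetilde V_1\otimes V_0)\oplus(\widetilde V_0\otimes V_1)$ is an isomorphism; 2. $\Omega^2S^4_q$, $\Omega^2_+S^4_q$, $\Omega^2_-S^4_q$ are $\mathcal A[S^4_q]$-bimodules and $(\mathrm{id}\otimes\theta_+,\mathrm{id}\otimes\theta_-)$ restricts to an isomorphism of $\mathcal A[S^4_q]$-bimodules $\Omega^2S^4_q\simeq\Omega^2_+S^4_q\oplus\Omega^2_-S^4_q$;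 3. more generally, for every right $\widetilde H\otimes H$-comodule algebra $P$ with coinvariants $M$, the same maps restrict to an isomorphism of $M$-bimodules $\mathcal M(V^{\wedge2})\simeq\mathcal M(\widetilde V_1\otimes V_0)\oplus\mathcal M(\widetilde V_0\otimes V_1)$. -/

import Mathlib

open scoped TensorProduct

set_option linter.unusedSimpArgs false

noncomputable section

namespace QSphere

/-- The deformation parameter: a real number `0 < q < 1`. -/
abbrev Param : Type := Set.Ioo (0 : ℝ) 1

/-- The deformation parameter as a complex number. -/
def qc (q : Param) : ℂ := ((q : ℝ) : ℂ)

/-- The normalisation `ζ = q^{-1/2}` as a complex number. -/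
def zeta (q : Param) : ℂ := (((Real.sqrt (q : ℝ))⁻¹ : ℝ) : ℂ)

theorem qc_ne_zero (q : Param) : qc q ≠ 0 := by
  have h : (q : ℝ) ≠ 0 := ne_of_gt q.2.1
  simpa [qc] using h

/-- The entries `R_i^j_k^l` of the R-matrix. -/
def Rmat (q : Param) (i j k l : Fin 2) : ℂ :=
  if i = j ∧ k = l then (if i = k then qc q else 1)
  else if i = 1 ∧ j = 0 ∧ k = 0 ∧ l = 1 then qc q - (qc q)⁻¹ else 0

/-! ### The quantum group `SU_q(2)` -/

/-- The free algebra on the four generators `a_i^j`. -/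
abbrev SUFree : Type := FreeAlgebra ℂ (Fin 2 × Fin 2)

/-- The free generator `a_i^j`; thus `a = a_0^0`, `b = a_0^1`, `c = a_1^0`, `d = a_1^1`. -/
def SUFree.g (i j : Fin 2) : SUFree := FreeAlgebra.ι ℂ (i, j)

/-- The defining relations of `A[SU_q(2)]`. -/
inductive SURel (q : Param) : SUFree → SUFree → Prop
  | ab : SURel q (.g 0 0 * .g 0 1) (qc q • (.g 0 1 * .g 0 0))
  | ac : SURel q (.g 0 0 * .g 1 0) (qc q • (.g 1 0 * .g 0 0))
  | bd : SURel q (.g 0 1 * .g 1 1) (qc q • (.g 1 1 * .g 0 1))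
  | cd : SURel q (.g 1 0 * .g 1 1) (qc q • (.g 1 1 * .g 1 0))
  | bc : SURel q (.g 0 1 * .g 1 0) (.g 1 0 * .g 0 1)
  | ad : SURel q (.g 0 0 * .g 1 1 - .g 1 1 * .g 0 0)
      ((qc q - (qc q)⁻¹) • (.g 0 1 * .g 1 0))
  | det : SURel q (.g 0 0 * .g 1 1 - qc q • (.g 0 1 * .g 1 0)) 1

/-- The coordinate algebra `H = A[SU_q(2)]`. -/
def SU (q : Param) : Type := RingQuot (SURel q)

instance (q : Param) : Ring (SU q) := inferInstanceAs (Ring (RingQuot (SURel q)))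

instance (q : Param) : Algebra ℂ (SU q) := inferInstanceAs (Algebra ℂ (RingQuot (SURel q)))

/-- The quotient map onto `A[SU_q(2)]`. -/
def SU.mk (q : Param) : SUFree →ₐ[ℂ] SU q := RingQuot.mkAlgHom ℂ (SURel q)

/-- The generator `a_i^j` of `A[SU_q(2)]`. -/
def SU.a (q : Param) (i j : Fin 2) : SU q := SU.mk q (.g i j)

section relations

variable (q : Param)

theorem SU.mk_rel {x y : SUFree} (h : SURel q x y) : SU.mk q x = SU.mk q y :=
  RingQuot.mkAlgHom_rel ℂ h

theorem SU.ba : SU.a q 0 1 * SU.a q 0 0 = (qc q)⁻¹ • (SU.a q 0 0 * SU.a q 0 1) := by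
  have h := SU.mk_rel q (SURel.ab (q := q))
  simp only [map_mul, map_smul] at h
  rw [eq_inv_smul_iff₀ (qc_ne_zero q)]; exact h.symm

theorem SU.ca : SU.a q 1 0 * SU.a q 0 0 = (qc q)⁻¹ • (SU.a q 0 0 * SU.a q 1 0) := by
  have h := SU.mk_rel q (SURel.ac (q := q))
  simp only [map_mul, map_smul] at h
  rw [eq_inv_smul_iff₀ (qc_ne_zero q)]; exact h.symm

theorem SU.db : SU.a q 1 1 * SU.a q 0 1 = (qc q)⁻¹ • (SU.a q 0 1 * SU.a q 1 1) := by
  have h := SU.mk_rel q (SURel.bd (q := q))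
  simp only [map_mul, map_smul] at h
  rw [eq_inv_smul_iff₀ (qc_ne_zero q)]; exact h.symm

theorem SU.dc : SU.a q 1 1 * SU.a q 1 0 = (qc q)⁻¹ • (SU.a q 1 0 * SU.a q 1 1) := by
  have h := SU.mk_rel q (SURel.cd (q := q))
  simp only [map_mul, map_smul] at h
  rw [eq_inv_smul_iff₀ (qc_ne_zero q)]; exact h.symm

theorem SU.cb : SU.a q 1 0 * SU.a q 0 1 = SU.a q 0 1 * SU.a q 1 0 := by
  have h := SU.mk_rel q (SURel.bc (q := q))
  simp only [map_mul] at h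
  exact h.symm

theorem SU.ad : SU.a q 0 0 * SU.a q 1 1 = 1 + qc q • (SU.a q 0 1 * SU.a q 1 0) := by
  have h := SU.mk_rel q (SURel.det (q := q))
  simp only [map_mul, map_smul, map_sub, map_one] at h
  exact sub_eq_iff_eq_add.1 h

theorem SU.da : SU.a q 1 1 * SU.a q 0 0 = 1 + (qc q)⁻¹ • (SU.a q 0 1 * SU.a q 1 0) := by
  have h := SU.mk_rel q (SURel.ad (q := q))
  simp only [map_mul, map_smul, map_sub] at h
  have h2 := SU.ad q
  change SU.a q 0 0 * SU.a q 1 1 - SU.a q 1 1 * SU.a q 0 0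
    = (qc q - (qc q)⁻¹) • (SU.a q 0 1 * SU.a q 1 0) at h
  rw [h2, sub_smul, sub_eq_iff_eq_add] at h
  have h3 : SU.a q 1 1 * SU.a q 0 0 = 1 + qc q • (SU.a q 0 1 * SU.a q 1 0) -
      (qc q • (SU.a q 0 1 * SU.a q 1 0) - (qc q)⁻¹ • (SU.a q 0 1 * SU.a q 1 0)) := by
    rw [h]; abel
  rw [h3]; abel

/-- Algebra maps out of `A[SU_q(2)]` from a matrix satisfying the relations. -/
def SU.lift {B : Type*} [Ring B] [Algebra ℂ B] (t : Fin 2 → Fin 2 → B)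
    (h : ∀ x y, SURel q x y → FreeAlgebra.lift ℂ (fun p : Fin 2 × Fin 2 => t p.1 p.2) x
      = FreeAlgebra.lift ℂ (fun p : Fin 2 × Fin 2 => t p.1 p.2) y) : SU q →ₐ[ℂ] B :=
  RingQuot.liftAlgHom ℂ ⟨FreeAlgebra.lift ℂ (fun p : Fin 2 × Fin 2 => t p.1 p.2), h⟩

@[simp] theorem SU.lift_a {B : Type*} [Ring B] [Algebra ℂ B] (t : Fin 2 → Fin 2 → B) (h)
    (i j : Fin 2) : SU.lift q t h (SU.a q i j) = t i j := by
  exact (RingQuot.liftAlgHom_mkAlgHom_apply ℂ _ _ _).trans (FreeAlgebra.lift_ι_apply _ _)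

theorem SU.algHom_ext {B : Type*} [Ring B] [Algebra ℂ B] {f g : SU q →ₐ[ℂ] B}
    (h : ∀ i j, f (SU.a q i j) = g (SU.a q i j)) : f = g := by
  apply RingQuot.ringQuot_ext'
  apply FreeAlgebra.hom_ext
  funext p
  exact h p.1 p.2

/-- The matrix coproduct `Δ(a_i^j) = a_i^μ ⊗ a_μ^j`. -/
def SU.comulHom : SU q →ₐ[ℂ] SU q ⊗[ℂ] SU q :=
  SU.lift q (fun i j => ∑ m, SU.a q i m ⊗ₜ[ℂ] SU.a q m j) (by
    have hq := qc_ne_zero q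
    intro x y h
    cases h <;>
    simp only [SUFree.g, map_mul, map_sub, map_smul, map_one, FreeAlgebra.lift_ι_apply,
      Fin.sum_univ_two, mul_add, add_mul, Algebra.TensorProduct.tmul_mul_tmul,
      SU.ba, SU.ca, SU.db, SU.dc, SU.cb, SU.ad, SU.da, ← TensorProduct.smul_tmul', mul_smul_comm, smul_mul_assoc,
      TensorProduct.tmul_smul, TensorProduct.add_tmul, TensorProduct.tmul_add, smul_add,
      smul_smul, Algebra.TensorProduct.one_def] <;>
    (match_scalars <;> (try field_simp) <;> (try ring)))

/-- The counit `ε(a_i^j) = δ_i^j`. -/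
def SU.counitHom : SU q →ₐ[ℂ] ℂ :=
  SU.lift q (fun i j => if i = j then 1 else 0) (by
    intro x y h
    cases h <;> simp [SUFree.g])

instance : Bialgebra ℂ (SU q) :=
  Bialgebra.ofAlgHom (SU.comulHom q) (SU.counitHom q)
    (by
      apply SU.algHom_ext
      intro i j
      simp [SU.comulHom, TensorProduct.tmul_add, TensorProduct.add_tmul]
      abel)
    (by
      apply SU.algHom_ext
      intro i j
      fin_cases i <;> fin_cases j <;>
      simp [SU.comulHom, SU.counitHom])
    (by
      apply SU.algHom_ext
      intro i j
      fin_cases i <;> fin_cases j <;>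
      simp [SU.comulHom, SU.counitHom])

theorem SU.comul_a (i j : Fin 2) : Coalgebra.comul (R := ℂ) (SU.a q i j)
    = ∑ m, SU.a q i m ⊗ₜ[ℂ] SU.a q m j := SU.lift_a q _ _ i j

theorem SU.counit_a (i j : Fin 2) : Coalgebra.counit (R := ℂ) (SU.a q i j)
    = if i = j then 1 else 0 := SU.lift_a q _ _ i j

end relations

/-- The value `S(a_i^j) = (a_j^i)^*` of the antipode of `A[SU_q(2)]` on the generators. -/
def SU.Sa (q : Param) (i j : Fin 2) : SU q :=
  if i = j then SU.a q i.rev j.rev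
  else if i = 0 then -(qc q)⁻¹ • SU.a q 0 1 else -qc q • SU.a q 1 0

/-- The value `S⁻¹(a_i^j)` of the inverse of the antipode of `A[SU_q(2)]` on the generators. -/
def SU.Sinva (q : Param) (i j : Fin 2) : SU q :=
  if i = j then SU.a q i.rev j.rev
  else if i = 0 then -qc q • SU.a q 0 1 else -(qc q)⁻¹ • SU.a q 1 0

theorem SU.Sa_mul_a (q : Param) (i j : Fin 2) :
    ∑ m, SU.Sa q i m * SU.a q m j = if i = j then 1 else 0 := by
  have hq := qc_ne_zero q
  fin_cases i <;> fin_cases j <;>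
  simp [SU.Sa, SU.ba, SU.ca, SU.db, SU.dc, SU.cb, SU.ad, SU.da, hq, smul_smul]

theorem SU.a_mul_Sa (q : Param) (i j : Fin 2) :
    ∑ m, SU.a q i m * SU.Sa q m j = if i = j then 1 else 0 := by
  have hq := qc_ne_zero q
  fin_cases i <;> fin_cases j <;>
  simp [SU.Sa, SU.ba, SU.ca, SU.db, SU.dc, SU.cb, SU.ad, SU.da, hq, smul_smul]

theorem SU.Sinva_mul_a (q : Param) (i j : Fin 2) :
    ∑ m, SU.Sinva q m j * SU.a q i m = if i = j then 1 else 0 := by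
  have hq := qc_ne_zero q
  fin_cases i <;> fin_cases j <;>
  simp [SU.Sinva, SU.ba, SU.ca, SU.db, SU.dc, SU.cb, SU.ad, SU.da, hq, smul_smul]

/-! ### The co-opposite quantum group -/

/-- `A[SU_q^cop(2)]`: the same algebra as `A[SU_q(2)]`, with the opposite coproduct. -/
def SUcop (q : Param) : Type := SU q

instance (q : Param) : Ring (SUcop q) := inferInstanceAs (Ring (SU q))

instance (q : Param) : Algebra ℂ (SUcop q) := inferInstanceAs (Algebra ℂ (SU q))

/-- An element of `A[SU_q(2)]`, regarded as an element of `A[SU_q^cop(2)]`. -/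
def SUcop.of (q : Param) : SU q ≃ₐ[ℂ] SUcop q := AlgEquiv.refl

/-- The coproduct of `A[SU_q^cop(2)]`. -/
def SUcop.comulHom (q : Param) : SUcop q →ₐ[ℂ] SUcop q ⊗[ℂ] SUcop q :=
  (Algebra.TensorProduct.map (SUcop.of q).toAlgHom (SUcop.of q).toAlgHom).comp
    ((Algebra.TensorProduct.comm ℂ (SU q) (SU q)).toAlgHom.comp
      ((SU.comulHom q).comp (SUcop.of q).symm.toAlgHom))

/-- The counit of `A[SU_q^cop(2)]`. -/
def SUcop.counitHom (q : Param) : SUcop q →ₐ[ℂ] ℂ :=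
  (SU.counitHom q).comp (SUcop.of q).symm.toAlgHom

theorem SUcop.comulHom_a (q : Param) (i j : Fin 2) :
    SUcop.comulHom q (SUcop.of q (SU.a q i j))
      = ∑ m, SUcop.of q (SU.a q m j) ⊗ₜ[ℂ] SUcop.of q (SU.a q i m) := by
  simp [SUcop.comulHom, SU.comulHom]

theorem SUcop.counitHom_a (q : Param) (i j : Fin 2) :
    SUcop.counitHom q (SUcop.of q (SU.a q i j)) = if i = j then 1 else 0 := by
  simp [SUcop.counitHom, SU.counitHom]

theorem SUcop.algHom_ext (q : Param) {B : Type*} [Ring B] [Algebra ℂ B] {f g : SUcop q →ₐ[ℂ] B}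
    (h : ∀ i j, f (SUcop.of q (SU.a q i j)) = g (SUcop.of q (SU.a q i j))) : f = g := by
  have h1 : f.comp (SUcop.of q).toAlgHom = g.comp (SUcop.of q).toAlgHom :=
    SU.algHom_ext q h
  ext x
  exact DFunLike.congr_fun h1 ((SUcop.of q).symm x)

instance (q : Param) : Bialgebra ℂ (SUcop q) :=
  Bialgebra.ofAlgHom (SUcop.comulHom q) (SUcop.counitHom q)
    (by
      apply SUcop.algHom_ext
      intro i j
      simp [SUcop.comulHom_a, TensorProduct.tmul_add, TensorProduct.add_tmul]
      abel)
    (by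
      apply SUcop.algHom_ext
      intro i j
      fin_cases i <;> fin_cases j <;>
      simp [SUcop.comulHom_a, SUcop.counitHom_a])
    (by
      apply SUcop.algHom_ext
      intro i j
      fin_cases i <;> fin_cases j <;>
      simp [SUcop.comulHom_a, SUcop.counitHom_a])

theorem SUcop.comul_a (q : Param) (i j : Fin 2) :
    Coalgebra.comul (R := ℂ) (SUcop.of q (SU.a q i j))
      = ∑ m, SUcop.of q (SU.a q m j) ⊗ₜ[ℂ] SUcop.of q (SU.a q i m) := SUcop.comulHom_a q i j

theorem SUcop.counit_a (q : Param) (i j : Fin 2) :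
    Coalgebra.counit (R := ℂ) (SUcop.of q (SU.a q i j)) = if i = j then 1 else 0 :=
  SUcop.counitHom_a q i j

/-- The bialgebra `A[SU_q^cop(2)] ⊗ A[SU_q(2)]`. -/
abbrev HH (q : Param) : Type := SUcop q ⊗[ℂ] SU q

/-! ### Right comodules -/

/-- A right comodule structure on `V` over the coalgebra `C`. -/
structure RightComodule (C V : Type*) [AddCommGroup C] [Module ℂ C] [Coalgebra ℂ C]
    [AddCommGroup V] [Module ℂ V] where
  /-- the coaction -/
  coact : V →ₗ[ℂ] V ⊗[ℂ] C
  coassoc : (TensorProduct.assoc ℂ V C C).toLinearMap ∘ₗ coact.rTensor C ∘ₗ coact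
    = (Coalgebra.comul (R := ℂ) (A := C)).lTensor V ∘ₗ coact
  counit : (TensorProduct.rid ℂ V).toLinearMap ∘ₗ
    (Coalgebra.counit (R := ℂ) (A := C)).lTensor V ∘ₗ coact = LinearMap.id

/-- A linear map intertwining the coactions. -/
def IsColinear {C V W : Type*} [AddCommGroup C] [Module ℂ C] [Coalgebra ℂ C]
    [AddCommGroup V] [Module ℂ V] [AddCommGroup W] [Module ℂ W]
    (ρ : RightComodule C V) (σ : RightComodule C W) (f : V →ₗ[ℂ] W) : Prop :=
  σ.coact ∘ₗ f = f.rTensor C ∘ₗ ρ.coact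

/-- A right comodule algebra: the coaction is an algebra map. -/
structure ComoduleAlgebra (C A : Type*) [Ring C] [Bialgebra ℂ C] [Ring A] [Algebra ℂ A]
    extends RightComodule C A where
  coact_one : coact 1 = 1
  coact_mul : ∀ x y, coact (x * y) = coact x * coact y

/-- The subalgebra of coinvariants `{p | δ(p) = p ⊗ 1}`. -/
def ComoduleAlgebra.coinvariants {C A : Type*} [Ring C] [Bialgebra ℂ C] [Ring A] [Algebra ℂ A]
    (δ : ComoduleAlgebra C A) : Subalgebra ℂ A where
  carrier := {p | δ.coact p = p ⊗ₜ[ℂ] 1}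
  mul_mem' := by
    intro x y hx hy
    simp only [Set.mem_ofPred_eq] at hx hy ⊢
    rw [δ.coact_mul, hx, hy, Algebra.TensorProduct.tmul_mul_tmul, one_mul]
  add_mem' := by
    intro x y hx hy
    simp only [Set.mem_ofPred_eq] at hx hy ⊢
    rw [map_add, hx, hy, TensorProduct.add_tmul]
  algebraMap_mem' := by
    intro r
    simp only [Set.mem_ofPred_eq, Algebra.algebraMap_eq_smul_one, map_smul, δ.coact_one]
    rfl

/-- A comodule algebra from a coaction that is an algebra map. -/
def ComoduleAlgebra.ofAlgHom {C A : Type*} [Ring C] [Bialgebra ℂ C] [Ring A] [Algebra ℂ A]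
    (f : A →ₐ[ℂ] A ⊗[ℂ] C)
    (h₁ : (Algebra.TensorProduct.assoc ℂ ℂ ℂ A C C).toAlgHom.comp
      ((Algebra.TensorProduct.map f (AlgHom.id ℂ C)).comp f)
      = (Algebra.TensorProduct.map (AlgHom.id ℂ A) (Bialgebra.comulAlgHom ℂ C)).comp f)
    (h₂ : (Algebra.TensorProduct.rid ℂ ℂ A).toAlgHom.comp
      ((Algebra.TensorProduct.map (AlgHom.id ℂ A) (Bialgebra.counitAlgHom ℂ C)).comp f)
      = AlgHom.id ℂ A) : ComoduleAlgebra C A where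
  coact := f.toLinearMap
  coassoc := congrArg AlgHom.toLinearMap h₁
  counit := congrArg AlgHom.toLinearMap h₂
  coact_one := map_one f
  coact_mul := map_mul f

section comodules

variable {C D V W : Type*} [AddCommGroup V] [Module ℂ V] [AddCommGroup W] [Module ℂ W]

/-- The comodule over `C ⊗ D` on `V ⊗ W`, for a `C`-comodule `V` and a `D`-comodule `W`:
`v ⊗ w ↦ v₀ ⊗ w₀ ⊗ (v₁ ⊗ w₁)`. -/
def RightComodule.external [Ring C] [Bialgebra ℂ C] [Ring D] [Bialgebra ℂ D]
    (ρ : RightComodule C V) (σ : RightComodule D W) : RightComodule (C ⊗[ℂ] D) (V ⊗[ℂ] W) where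
  coact := (TensorProduct.tensorTensorTensorComm ℂ V C W D).toLinearMap ∘ₗ
    TensorProduct.map ρ.coact σ.coact
  coassoc := by
    let Θ : (V ⊗[ℂ] (C ⊗[ℂ] C)) ⊗[ℂ] (W ⊗[ℂ] (D ⊗[ℂ] D)) →ₗ[ℂ]
        (V ⊗[ℂ] W) ⊗[ℂ] ((C ⊗[ℂ] D) ⊗[ℂ] (C ⊗[ℂ] D)) :=
      (TensorProduct.tensorTensorTensorComm ℂ C C D D).toLinearMap.lTensor (V ⊗[ℂ] W) ∘ₗ
        (TensorProduct.tensorTensorTensorComm ℂ V (C ⊗[ℂ] C) W (D ⊗[ℂ] D)).toLinearMap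
    set τ := (TensorProduct.tensorTensorTensorComm ℂ V C W D).toLinearMap with hτ
    have L : ∀ (s : V ⊗[ℂ] C) (t : W ⊗[ℂ] D),
        TensorProduct.assoc ℂ (V ⊗[ℂ] W) (C ⊗[ℂ] D) (C ⊗[ℂ] D)
          ((τ ∘ₗ TensorProduct.map ρ.coact σ.coact).rTensor (C ⊗[ℂ] D) (τ (s ⊗ₜ t)))
        = Θ ((TensorProduct.assoc ℂ V C C (ρ.coact.rTensor C s)) ⊗ₜ
            (TensorProduct.assoc ℂ W D D (σ.coact.rTensor D t))) := by
      intro s t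
      induction s using TensorProduct.induction_on with
      | zero => simp
      | add x y hx hy => simp only [TensorProduct.add_tmul, map_add, hx, hy]
      | tmul v c =>
        induction t using TensorProduct.induction_on with
        | zero => simp
        | add x y hx hy => simp only [TensorProduct.tmul_add, map_add, hx, hy]
        | tmul w d =>
          simp only [hτ, LinearEquiv.coe_coe, TensorProduct.tensorTensorTensorComm_tmul,
            LinearMap.rTensor_tmul, LinearMap.comp_apply, TensorProduct.map_tmul]
          generalize ρ.coact v = s'
          generalize σ.coact w = t'
          induction s' using TensorProduct.induction_on with
          | zero => simp
          | add x y hx hy => simp only [TensorProduct.add_tmul, map_add, hx, hy]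
          | tmul v c =>
            induction t' using TensorProduct.induction_on with
            | zero => simp
            | add x y hx hy =>
              simp only [TensorProduct.tmul_add, TensorProduct.add_tmul, map_add, hx, hy]
            | tmul w d => simp [Θ]
    have R : ∀ (s : V ⊗[ℂ] C) (t : W ⊗[ℂ] D),
        (Coalgebra.comul (R := ℂ) (A := C ⊗[ℂ] D)).lTensor (V ⊗[ℂ] W) (τ (s ⊗ₜ t))
        = Θ (((Coalgebra.comul (R := ℂ) (A := C)).lTensor V s) ⊗ₜ
            ((Coalgebra.comul (R := ℂ) (A := D)).lTensor W t)) := by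
      intro s t
      induction s using TensorProduct.induction_on with
      | zero => simp
      | add x y hx hy => simp only [TensorProduct.add_tmul, map_add, hx, hy]
      | tmul v c =>
        induction t using TensorProduct.induction_on with
        | zero => simp
        | add x y hx hy => simp only [TensorProduct.tmul_add, map_add, hx, hy]
        | tmul w d =>
          simp [hτ, Θ]
          rfl
    refine TensorProduct.ext' fun v w => ?_
    have h1 := LinearMap.congr_fun ρ.coassoc v
    have h2 := LinearMap.congr_fun σ.coassoc w
    simp only [LinearMap.comp_apply, LinearEquiv.coe_coe] at h1 h2
    simp only [LinearMap.comp_apply, LinearEquiv.coe_coe, TensorProduct.map_tmul]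
    rw [L, R, h1, h2]
  counit := by
    set τ := (TensorProduct.tensorTensorTensorComm ℂ V C W D).toLinearMap with hτ
    have L : ∀ (s : V ⊗[ℂ] C) (t : W ⊗[ℂ] D),
        TensorProduct.rid ℂ (V ⊗[ℂ] W)
          ((Coalgebra.counit (R := ℂ) (A := C ⊗[ℂ] D)).lTensor (V ⊗[ℂ] W) (τ (s ⊗ₜ t)))
        = (TensorProduct.rid ℂ V ((Coalgebra.counit (R := ℂ) (A := C)).lTensor V s)) ⊗ₜ
          (TensorProduct.rid ℂ W ((Coalgebra.counit (R := ℂ) (A := D)).lTensor W t)) := by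
      intro s t
      induction s using TensorProduct.induction_on with
      | zero => simp
      | add x y hx hy => simp only [TensorProduct.add_tmul, map_add, hx, hy]
      | tmul v c =>
        induction t using TensorProduct.induction_on with
        | zero => simp
        | add x y hx hy => simp only [TensorProduct.tmul_add, map_add, hx, hy]
        | tmul w d =>
          simp [hτ, TensorProduct.smul_tmul', TensorProduct.tmul_smul, smul_smul, mul_comm]
    refine TensorProduct.ext' fun v w => ?_
    have h1 := LinearMap.congr_fun ρ.counit v
    have h2 := LinearMap.congr_fun σ.counit w
    simp only [LinearMap.comp_apply, LinearEquiv.coe_coe, LinearMap.id_apply] at h1 h2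
    simp only [LinearMap.comp_apply, LinearEquiv.coe_coe, TensorProduct.map_tmul,
      LinearMap.id_apply]
    rw [L, h1, h2]

/-- The tensor product of two comodules over a bialgebra: `v ⊗ w ↦ v₀ ⊗ w₀ ⊗ v₁ w₁`. -/
def RightComodule.tensor [Ring C] [Bialgebra ℂ C]
    (ρ : RightComodule C V) (σ : RightComodule C W) : RightComodule C (V ⊗[ℂ] W) where
  coact := (LinearMap.mul' ℂ C).lTensor (V ⊗[ℂ] W) ∘ₗ
    (TensorProduct.tensorTensorTensorComm ℂ V C W C).toLinearMap ∘ₗ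
    TensorProduct.map ρ.coact σ.coact
  coassoc := by
    let Θ : (V ⊗[ℂ] (C ⊗[ℂ] C)) ⊗[ℂ] (W ⊗[ℂ] (C ⊗[ℂ] C)) →ₗ[ℂ]
        (V ⊗[ℂ] W) ⊗[ℂ] (C ⊗[ℂ] C) :=
      (LinearMap.mul' ℂ (C ⊗[ℂ] C)).lTensor (V ⊗[ℂ] W) ∘ₗ
        (TensorProduct.tensorTensorTensorComm ℂ V (C ⊗[ℂ] C) W (C ⊗[ℂ] C)).toLinearMap
    set τ := (LinearMap.mul' ℂ C).lTensor (V ⊗[ℂ] W) ∘ₗ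
      (TensorProduct.tensorTensorTensorComm ℂ V C W C).toLinearMap with hτ
    have L : ∀ (s : V ⊗[ℂ] C) (t : W ⊗[ℂ] C),
        TensorProduct.assoc ℂ (V ⊗[ℂ] W) C C
          ((τ ∘ₗ TensorProduct.map ρ.coact σ.coact).rTensor C (τ (s ⊗ₜ t)))
        = Θ ((TensorProduct.assoc ℂ V C C (ρ.coact.rTensor C s)) ⊗ₜ
            (TensorProduct.assoc ℂ W C C (σ.coact.rTensor C t))) := by
      intro s t
      induction s using TensorProduct.induction_on with
      | zero => simp
      | add x y hx hy => simp only [TensorProduct.add_tmul, map_add, hx, hy]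
      | tmul v c =>
        induction t using TensorProduct.induction_on with
        | zero => simp
        | add x y hx hy => simp only [TensorProduct.tmul_add, map_add, hx, hy]
        | tmul w d =>
          simp only [hτ, LinearEquiv.coe_coe, TensorProduct.tensorTensorTensorComm_tmul,
            LinearMap.rTensor_tmul, LinearMap.lTensor_tmul, LinearMap.comp_apply,
            TensorProduct.map_tmul, LinearMap.mul'_apply]
          generalize ρ.coact v = s'
          generalize σ.coact w = t'
          induction s' using TensorProduct.induction_on with
          | zero => simp
          | add x y hx hy => simp only [TensorProduct.add_tmul, map_add, hx, hy]
          | tmul v c =>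
            induction t' using TensorProduct.induction_on with
            | zero => simp
            | add x y hx hy =>
              simp only [TensorProduct.tmul_add, TensorProduct.add_tmul, map_add, hx, hy]
            | tmul w d => simp [Θ]
    have R : ∀ (s : V ⊗[ℂ] C) (t : W ⊗[ℂ] C),
        (Coalgebra.comul (R := ℂ) (A := C)).lTensor (V ⊗[ℂ] W) (τ (s ⊗ₜ t))
        = Θ (((Coalgebra.comul (R := ℂ) (A := C)).lTensor V s) ⊗ₜ
            ((Coalgebra.comul (R := ℂ) (A := C)).lTensor W t)) := by
      intro s t
      induction s using TensorProduct.induction_on with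
      | zero => simp
      | add x y hx hy => simp only [TensorProduct.add_tmul, map_add, hx, hy]
      | tmul v c =>
        induction t using TensorProduct.induction_on with
        | zero => simp
        | add x y hx hy => simp only [TensorProduct.tmul_add, map_add, hx, hy]
        | tmul w d => simp [hτ, Θ]
    refine TensorProduct.ext' fun v w => ?_
    have h1 := LinearMap.congr_fun ρ.coassoc v
    have h2 := LinearMap.congr_fun σ.coassoc w
    simp only [LinearMap.comp_apply, LinearEquiv.coe_coe] at h1 h2
    have e1 := L (ρ.coact v) (σ.coact w)
    have e2 := R (ρ.coact v) (σ.coact w)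
    rw [h1, h2, ← e2] at e1
    exact e1
  counit := by
    set τ := (LinearMap.mul' ℂ C).lTensor (V ⊗[ℂ] W) ∘ₗ
      (TensorProduct.tensorTensorTensorComm ℂ V C W C).toLinearMap with hτ
    have L : ∀ (s : V ⊗[ℂ] C) (t : W ⊗[ℂ] C),
        TensorProduct.rid ℂ (V ⊗[ℂ] W)
          ((Coalgebra.counit (R := ℂ) (A := C)).lTensor (V ⊗[ℂ] W) (τ (s ⊗ₜ t)))
        = (TensorProduct.rid ℂ V ((Coalgebra.counit (R := ℂ) (A := C)).lTensor V s)) ⊗ₜ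
          (TensorProduct.rid ℂ W ((Coalgebra.counit (R := ℂ) (A := C)).lTensor W t)) := by
      intro s t
      induction s using TensorProduct.induction_on with
      | zero => simp
      | add x y hx hy => simp only [TensorProduct.add_tmul, map_add, hx, hy]
      | tmul v c =>
        induction t using TensorProduct.induction_on with
        | zero => simp
        | add x y hx hy => simp only [TensorProduct.tmul_add, map_add, hx, hy]
        | tmul w d =>
          simp [hτ, TensorProduct.smul_tmul', TensorProduct.tmul_smul, smul_smul, mul_comm]
    refine TensorProduct.ext' fun v w => ?_
    have h1 := LinearMap.congr_fun ρ.counit v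
    have h2 := LinearMap.congr_fun σ.counit w
    simp only [LinearMap.comp_apply, LinearEquiv.coe_coe, LinearMap.id_apply] at h1 h2
    have e1 := L (ρ.coact v) (σ.coact w)
    rw [h1, h2] at e1
    exact e1

/-- The restriction of a coaction to a subspace `U` with `ρ(U) ⊆ U ⊗ C`. -/
def RightComodule.sub [Ring C] [Bialgebra ℂ C] (ρ : RightComodule C V) (U : Submodule ℂ V)
    (h : ∀ u ∈ U, ρ.coact u ∈ LinearMap.range (U.subtype.rTensor C)) : RightComodule C U where
  coact := (LinearEquiv.ofInjective (U.subtype.rTensor C)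
      (Module.Flat.rTensor_preserves_injective_linearMap _ U.injective_subtype)).symm.toLinearMap
    ∘ₗ (ρ.coact ∘ₗ U.subtype).codRestrict _ (fun u => h u u.2)
  coassoc := by
    set κ := (LinearEquiv.ofInjective (U.subtype.rTensor C)
      (Module.Flat.rTensor_preserves_injective_linearMap _ U.injective_subtype)).symm.toLinearMap
      ∘ₗ (ρ.coact ∘ₗ U.subtype).codRestrict _ (fun u => h u u.2) with hκ
    have hk : U.subtype.rTensor C ∘ₗ κ = ρ.coact ∘ₗ U.subtype := by
      ext u
      simp only [LinearMap.comp_apply, hκ]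
      exact congrArg Subtype.val (LinearEquiv.apply_symm_apply
        (LinearEquiv.ofInjective (U.subtype.rTensor C)
        (Module.Flat.rTensor_preserves_injective_linearMap _ U.injective_subtype)) _)
    have inj : Function.Injective (U.subtype.rTensor (C ⊗[ℂ] C)) :=
      Module.Flat.rTensor_preserves_injective_linearMap _ U.injective_subtype
    ext u
    apply inj
    have key := LinearMap.congr_fun ρ.coassoc u
    have e1 : ∀ z : U ⊗[ℂ] C, U.subtype.rTensor (C ⊗[ℂ] C)
        (TensorProduct.assoc ℂ U C C (κ.rTensor C z))
        = TensorProduct.assoc ℂ V C C (ρ.coact.rTensor C (U.subtype.rTensor C z)) := by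
      intro z
      induction z using TensorProduct.induction_on with
      | zero => simp
      | add x y hx hy => simp only [map_add, hx, hy]
      | tmul v c =>
        have := LinearMap.congr_fun hk v
        simp only [LinearMap.comp_apply, Submodule.subtype_apply] at this
        simp only [LinearMap.rTensor_tmul, Submodule.subtype_apply, ← this]
        generalize κ v = s'
        induction s' using TensorProduct.induction_on with
        | zero => simp
        | add x y hx hy => simp only [TensorProduct.add_tmul, map_add, hx, hy]
        | tmul v c => simp
    have e2 : ∀ z : U ⊗[ℂ] C, U.subtype.rTensor (C ⊗[ℂ] C)
        ((Coalgebra.comul (R := ℂ) (A := C)).lTensor U z)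
        = (Coalgebra.comul (R := ℂ) (A := C)).lTensor V (U.subtype.rTensor C z) := by
      intro z
      induction z using TensorProduct.induction_on with
      | zero => simp
      | add x y hx hy => simp only [map_add, hx, hy]
      | tmul v c => simp
    have hu := LinearMap.congr_fun hk u
    simp only [LinearMap.comp_apply, LinearEquiv.coe_coe, Submodule.subtype_apply] at key hu ⊢
    rw [e1, e2, hu, key]
  counit := by
    set κ := (LinearEquiv.ofInjective (U.subtype.rTensor C)
      (Module.Flat.rTensor_preserves_injective_linearMap _ U.injective_subtype)).symm.toLinearMap
      ∘ₗ (ρ.coact ∘ₗ U.subtype).codRestrict _ (fun u => h u u.2) with hκ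
    have hk : U.subtype.rTensor C ∘ₗ κ = ρ.coact ∘ₗ U.subtype := by
      ext u
      simp only [LinearMap.comp_apply, hκ]
      exact congrArg Subtype.val (LinearEquiv.apply_symm_apply
        (LinearEquiv.ofInjective (U.subtype.rTensor C)
        (Module.Flat.rTensor_preserves_injective_linearMap _ U.injective_subtype)) _)
    ext u
    have key := LinearMap.congr_fun ρ.counit u
    have e2 : ∀ z : U ⊗[ℂ] C, ((TensorProduct.rid ℂ U
        ((Coalgebra.counit (R := ℂ) (A := C)).lTensor U z) : U) : V)
        = TensorProduct.rid ℂ V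
          ((Coalgebra.counit (R := ℂ) (A := C)).lTensor V (U.subtype.rTensor C z)) := by
      intro z
      induction z using TensorProduct.induction_on with
      | zero => simp
      | add x y hx hy => simp only [map_add, hx, hy, Submodule.coe_add]
      | tmul v c => simp
    have hu := LinearMap.congr_fun hk u
    simp only [LinearMap.comp_apply, LinearEquiv.coe_coe, Submodule.subtype_apply,
      LinearMap.id_apply] at key hu ⊢
    rw [e2, hu, key]

/-- The comodule on `ℂⁿ` given by a matrix of coefficients: `e_k ↦ e_m ⊗ t_m^k`. -/
def RightComodule.ofMatrix [Ring C] [Bialgebra ℂ C] {n : ℕ} (t : Fin n → Fin n → C)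
    (h₁ : ∀ i j, Coalgebra.comul (R := ℂ) (t i j) = ∑ m, t i m ⊗ₜ[ℂ] t m j)
    (h₂ : ∀ i j, Coalgebra.counit (R := ℂ) (t i j) = if i = j then 1 else 0) :
    RightComodule C (Fin n → ℂ) where
  coact := (Pi.basisFun ℂ (Fin n)).constr ℂ (fun k => ∑ m, Pi.single m (1 : ℂ) ⊗ₜ[ℂ] t m k)
  coassoc := by
    refine (Pi.basisFun ℂ (Fin n)).ext fun k => ?_
    have hc : ∀ k, (Pi.basisFun ℂ (Fin n)).constr ℂ
        (fun k => ∑ m, Pi.single m (1 : ℂ) ⊗ₜ[ℂ] t m k) (Pi.single k 1)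
        = ∑ m, Pi.single m (1 : ℂ) ⊗ₜ[ℂ] t m k := by
      intro k
      rw [← Pi.basisFun_apply ℂ, Module.Basis.constr_basis]
    simp only [LinearMap.comp_apply, Module.Basis.constr_basis, map_sum, LinearMap.rTensor_tmul,
      LinearMap.lTensor_tmul, h₁, hc, TensorProduct.sum_tmul, TensorProduct.tmul_sum,
      LinearEquiv.coe_coe, TensorProduct.assoc_tmul]
    exact Finset.sum_comm
  counit := by
    refine (Pi.basisFun ℂ (Fin n)).ext fun k => ?_
    simp [h₂, Module.Basis.constr_basis]

end comodules

/-- A subspace `U` of a comodule is a subcomodule if its coaction takes values in `U ⊗ C`. -/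
def RightComodule.IsSub {C V : Type*} [AddCommGroup V] [Module ℂ V] [Ring C] [Bialgebra ℂ C]
    (ρ : RightComodule C V) (U : Submodule ℂ V) : Prop :=
  ∀ u ∈ U, ρ.coact u ∈ LinearMap.range (U.subtype.rTensor C)

theorem ComoduleAlgebra.isSub_mul {C A : Type*} [Ring C] [Bialgebra ℂ C] [Ring A] [Algebra ℂ A]
    (δ : ComoduleAlgebra C A) {S T : Submodule ℂ A} (hS : δ.IsSub S) (hT : δ.IsSub T) :
    δ.IsSub (S * T) := by
  have key : ∀ (x : S ⊗[ℂ] C) (y : T ⊗[ℂ] C), S.subtype.rTensor C x * T.subtype.rTensor C y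
      ∈ LinearMap.range ((S * T).subtype.rTensor C) := by
    intro x y
    induction x using TensorProduct.induction_on with
    | zero => simp
    | add x x' hx hx' => rw [map_add, add_mul]; exact add_mem hx hx'
    | tmul s c =>
      induction y using TensorProduct.induction_on with
      | zero => simp
      | add y y' hy hy' => rw [map_add, mul_add]; exact add_mem hy hy'
      | tmul t d =>
        exact ⟨(⟨s * t, Submodule.mul_mem_mul s.2 t.2⟩ : ↥(S * T)) ⊗ₜ[ℂ] (c * d), by simp⟩
  intro u hu
  induction hu using Submodule.mul_induction_on' with
  | mem_mul_mem s hs t ht =>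
    obtain ⟨x, hx⟩ := hS s hs
    obtain ⟨y, hy⟩ := hT t ht
    rw [δ.coact_mul, ← hx, ← hy]
    exact key x y
  | add x hx y hy h1 h2 => rw [map_add]; exact add_mem h1 h2

theorem ComoduleAlgebra.isSub_pow {C A : Type*} [Ring C] [Bialgebra ℂ C] [Ring A] [Algebra ℂ A]
    (δ : ComoduleAlgebra C A) {S : Submodule ℂ A} (hS : δ.IsSub S) (n : ℕ) :
    δ.IsSub (S ^ n) := by
  induction n with
  | zero =>
    intro u hu
    rw [pow_zero] at hu
    obtain ⟨r, rfl⟩ := Submodule.mem_one.1 hu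
    refine ⟨(⟨algebraMap ℂ A r, hu⟩ : ↥(S ^ 0)) ⊗ₜ[ℂ] (1 : C), ?_⟩
    simp only [Algebra.algebraMap_eq_smul_one, map_smul, δ.coact_one]
    rfl
  | succ n ih => rw [pow_succ]; exact δ.isSub_mul ih hS

/-- An eigenspace of a colinear endomorphism is a subcomodule. -/
theorem IsColinear.isSub_eigenspace {C V : Type*} [AddCommGroup V] [Module ℂ V] [Ring C]
    [Bialgebra ℂ C] {ρ : RightComodule C V} {f : V →ₗ[ℂ] V} (hf : IsColinear ρ ρ f) (a : ℂ) :
    ρ.IsSub (Module.End.eigenspace f a) := by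
  intro u hu
  have ex : Function.Exact (Module.End.eigenspace f a).subtype (f - a • (LinearMap.id : V →ₗ[ℂ] V)) := by
    intro x
    simp [Module.End.mem_eigenspace_iff, sub_eq_zero]
  have ex' := Module.Flat.rTensor_exact C ex
  refine (ex' _).1 ?_
  rw [Module.End.mem_eigenspace_iff] at hu
  have h1 := LinearMap.congr_fun hf u
  simp only [LinearMap.comp_apply, hu, map_smul] at h1
  rw [LinearMap.rTensor_sub, LinearMap.sub_apply, ← h1, LinearMap.rTensor_smul,
    LinearMap.smul_apply, LinearMap.rTensor_id, LinearMap.id_apply, sub_self]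

/-! ### Quantum planes and the spin `j` comodules -/

/-- The relation `x y = lam • y x` of the quantum plane. -/
inductive QPlaneRel (lam : ℂ) : FreeAlgebra ℂ (Fin 2) → FreeAlgebra ℂ (Fin 2) → Prop
  | xy : QPlaneRel lam (FreeAlgebra.ι ℂ 0 * FreeAlgebra.ι ℂ 1)
      (lam • (FreeAlgebra.ι ℂ 1 * FreeAlgebra.ι ℂ 0))

/-- The unital algebra generated by `x, y` subject to `x y = lam • y x`. -/
def QPlane (lam : ℂ) : Type := RingQuot (QPlaneRel lam)

instance (lam : ℂ) : Ring (QPlane lam) := inferInstanceAs (Ring (RingQuot (QPlaneRel lam)))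

instance (lam : ℂ) : Algebra ℂ (QPlane lam) :=
  inferInstanceAs (Algebra ℂ (RingQuot (QPlaneRel lam)))

/-- The generators `x = gen 0` and `y = gen 1` of the quantum plane. -/
def QPlane.gen (lam : ℂ) (k : Fin 2) : QPlane lam :=
  RingQuot.mkAlgHom ℂ (QPlaneRel lam) (FreeAlgebra.ι ℂ k)

theorem QPlane.xy (lam : ℂ) : QPlane.gen lam 0 * QPlane.gen lam 1
    = lam • (QPlane.gen lam 1 * QPlane.gen lam 0) := by
  have h := RingQuot.mkAlgHom_rel ℂ (QPlaneRel.xy (lam := lam))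
  simp only [map_mul, map_smul] at h
  exact h

/-- The subspace of homogeneous polynomials of degree `n`. -/
def QPlane.deg (lam : ℂ) (n : ℕ) : Submodule ℂ (QPlane lam) :=
  Submodule.span ℂ (Set.range (QPlane.gen lam)) ^ n

/-- Algebra maps out of the quantum plane. -/
def QPlane.lift (lam : ℂ) {B : Type*} [Ring B] [Algebra ℂ B] (f : Fin 2 → B)
    (h : f 0 * f 1 = lam • (f 1 * f 0)) : QPlane lam →ₐ[ℂ] B :=
  RingQuot.liftAlgHom ℂ ⟨FreeAlgebra.lift ℂ f, by
    intro x y hxy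
    cases hxy
    simpa using h⟩

@[simp] theorem QPlane.lift_gen (lam : ℂ) {B : Type*} [Ring B] [Algebra ℂ B] (f : Fin 2 → B) (h)
    (k : Fin 2) : QPlane.lift lam f h (QPlane.gen lam k) = f k :=
  (RingQuot.liftAlgHom_mkAlgHom_apply ℂ _ _ _).trans (FreeAlgebra.lift_ι_apply _ _)

theorem QPlane.algHom_ext (lam : ℂ) {B : Type*} [Ring B] [Algebra ℂ B] {f g : QPlane lam →ₐ[ℂ] B}
    (h : ∀ k, f (QPlane.gen lam k) = g (QPlane.gen lam k)) : f = g := by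
  apply RingQuot.ringQuot_ext'
  apply FreeAlgebra.hom_ext
  funext k
  exact h k

/-- The comodule algebra structure `x_k ↦ x_m ⊗ t_m^k` on the quantum plane, for a matrix
coalgebra `t` for which it respects the relation `x y = lam • y x`. -/
def QPlane.comodule (lam : ℂ) {C : Type*} [Ring C] [Bialgebra ℂ C] (t : Fin 2 → Fin 2 → C)
    (h₁ : ∀ i j, Coalgebra.comul (R := ℂ) (t i j) = ∑ m, t i m ⊗ₜ[ℂ] t m j)
    (h₂ : ∀ i j, Coalgebra.counit (R := ℂ) (t i j) = if i = j then 1 else 0)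
    (h₃ : (∑ m, QPlane.gen lam m ⊗ₜ[ℂ] t m 0) * (∑ m, QPlane.gen lam m ⊗ₜ[ℂ] t m 1)
      = lam • ((∑ m, QPlane.gen lam m ⊗ₜ[ℂ] t m 1) * (∑ m, QPlane.gen lam m ⊗ₜ[ℂ] t m 0))) :
    ComoduleAlgebra C (QPlane lam) :=
  ComoduleAlgebra.ofAlgHom
    (QPlane.lift lam (fun k => ∑ m, QPlane.gen lam m ⊗ₜ[ℂ] t m k) h₃)
    (by
      apply QPlane.algHom_ext
      intro k
      simp [h₁, TensorProduct.tmul_add, TensorProduct.add_tmul]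
      abel)
    (by
      apply QPlane.algHom_ext
      intro k
      fin_cases k <;> simp [h₂])

theorem QPlane.comodule_isSub (lam : ℂ) {C : Type*} [Ring C] [Bialgebra ℂ C]
    (t : Fin 2 → Fin 2 → C) (h₁) (h₂) (h₃) (n : ℕ) :
    (QPlane.comodule lam t h₁ h₂ h₃).IsSub (QPlane.deg lam n) := by
  apply ComoduleAlgebra.isSub_pow
  have hg : ∀ m, QPlane.gen lam m ∈ Submodule.span ℂ (Set.range (QPlane.gen lam)) :=
    fun m => Submodule.subset_span ⟨m, rfl⟩
  intro u hu
  induction hu using Submodule.span_induction with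
  | mem x hx =>
    obtain ⟨k, rfl⟩ := hx
    refine ⟨∑ m, (⟨QPlane.gen lam m, hg m⟩ :
      ↥(Submodule.span ℂ (Set.range (QPlane.gen lam)))) ⊗ₜ[ℂ] t m k, ?_⟩
    rw [map_sum]
    have e := QPlane.lift_gen lam (fun k => ∑ m, QPlane.gen lam m ⊗ₜ[ℂ] t m k) h₃ k
    refine Eq.trans ?_ e.symm
    simp
  | zero => simp
  | add x y _ _ hx hy => rw [map_add]; exact add_mem hx hy
  | smul a x _ hx => rw [map_smul]; exact Submodule.smul_mem _ a hx

variable (q : Param)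

/-- The matrix `S̃(a_m^k)` of elements of `A[SU_q^cop(2)]`, where `S̃ = S⁻¹` is the antipode. -/
def tcop (m k : Fin 2) : SUcop q := SUcop.of q (SU.Sinva q m k)

theorem comul_tcop (i j : Fin 2) :
    Coalgebra.comul (R := ℂ) (tcop q i j) = ∑ m, tcop q i m ⊗ₜ[ℂ] tcop q m j := by
  have hq := qc_ne_zero q
  fin_cases i <;> fin_cases j <;>
  simp [tcop, SU.Sinva, SUcop.comul_a, TensorProduct.tmul_smul, TensorProduct.tmul_neg,
    TensorProduct.neg_tmul, ← TensorProduct.smul_tmul', smul_smul, hq] <;>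
  abel

theorem counit_tcop (i j : Fin 2) :
    Coalgebra.counit (R := ℂ) (tcop q i j) = if i = j then 1 else 0 := by
  fin_cases i <;> fin_cases j <;> simp [tcop, SU.Sinva, SUcop.counit_a]

/-- The fundamental comodule `V_{1/2}` of `A[SU_q(2)]`: `x_k ↦ x_m ⊗ a_m^k`. -/
def Vhalf : RightComodule (SU q) (Fin 2 → ℂ) :=
  RightComodule.ofMatrix (SU.a q) (SU.comul_a q) (SU.counit_a q)

/-- The fundamental comodule `Ṽ_{1/2}` of `A[SU_q^cop(2)]`: `x_k ↦ x_m ⊗ S̃(a_m^k)`. -/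
def VhalfCop : RightComodule (SUcop q) (Fin 2 → ℂ) :=
  RightComodule.ofMatrix (tcop q) (comul_tcop q) (counit_tcop q)

/-- The quantum plane `x y = q y x` as a comodule algebra over `A[SU_q(2)]`. -/
def plane : ComoduleAlgebra (SU q) (QPlane (qc q)) :=
  QPlane.comodule (qc q) (SU.a q) (SU.comul_a q) (SU.counit_a q) (by
    have hq := qc_ne_zero q
    simp only [Fin.sum_univ_two, mul_add, add_mul, Algebra.TensorProduct.tmul_mul_tmul,
      SU.ba, SU.ca, SU.db, SU.dc, SU.cb, SU.ad, SU.da, QPlane.xy,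
      ← TensorProduct.smul_tmul', TensorProduct.tmul_smul, TensorProduct.add_tmul,
      TensorProduct.tmul_add, smul_add, smul_smul]
    (match_scalars <;> (try field_simp)))

/-- The quantum plane `x y = q⁻¹ y x` as a comodule algebra over `A[SU_q^cop(2)]`. -/
def planeCop : ComoduleAlgebra (SUcop q) (QPlane (qc q)⁻¹) :=
  QPlane.comodule (qc q)⁻¹ (tcop q) (comul_tcop q) (counit_tcop q) (by
    have hq := qc_ne_zero q
    simp only [tcop, SU.Sinva, Fin.sum_univ_two, mul_add, add_mul,
      Algebra.TensorProduct.tmul_mul_tmul, ← map_mul]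
    simp [SU.ba, SU.ca, SU.db, SU.dc, SU.cb, SU.ad, SU.da, QPlane.xy,
      ← TensorProduct.smul_tmul', TensorProduct.tmul_smul, TensorProduct.add_tmul,
      TensorProduct.tmul_add, TensorProduct.tmul_neg, smul_add, smul_smul]
    (match_scalars <;> (try field_simp)))

/-- The spin `n/2` comodule `V_{n/2}` of `A[SU_q(2)]`: polynomials of degree `n`. -/
def V (n : ℕ) : RightComodule (SU q) (QPlane.deg (qc q) n) :=
  (plane q).sub _ (QPlane.comodule_isSub _ _ _ _ _ n)

/-- The spin `n/2` comodule `Ṽ_{n/2}` of `A[SU_q^cop(2)]`: polynomials of degree `n`. -/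
def Vcop (n : ℕ) : RightComodule (SUcop q) (QPlane.deg (qc q)⁻¹ n) :=
  (planeCop q).sub _ (QPlane.comodule_isSub _ _ _ _ _ n)

/-! ### The braidings and the `q`-antisymmetric tensors -/

/-- The endomorphism `e_k ⊗ e_l ↦ r_m^k_n^l e_n ⊗ e_m` of `ℂ² ⊗ ℂ²`. -/
def braiding (r : Fin 2 → Fin 2 → Fin 2 → Fin 2 → ℂ) :
    (Fin 2 → ℂ) ⊗[ℂ] (Fin 2 → ℂ) →ₗ[ℂ] (Fin 2 → ℂ) ⊗[ℂ] (Fin 2 → ℂ) :=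
  ((Pi.basisFun ℂ (Fin 2)).tensorProduct (Pi.basisFun ℂ (Fin 2))).constr ℂ
    (fun p => ∑ m, ∑ n, r m p.1 n p.2 • (Pi.single n (1 : ℂ) ⊗ₜ[ℂ] Pi.single m (1 : ℂ)))

theorem braiding_single (r : Fin 2 → Fin 2 → Fin 2 → Fin 2 → ℂ) (k l : Fin 2) :
    braiding r (Pi.single k 1 ⊗ₜ[ℂ] Pi.single l 1)
      = ∑ m, ∑ n, r m k n l • (Pi.single n (1 : ℂ) ⊗ₜ[ℂ] Pi.single m (1 : ℂ)) := by
  have h := ((Pi.basisFun ℂ (Fin 2)).tensorProduct (Pi.basisFun ℂ (Fin 2))).constr_basis ℂ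
    (fun p => ∑ m, ∑ n, r m p.1 n p.2 • (Pi.single n (1 : ℂ) ⊗ₜ[ℂ] Pi.single m (1 : ℂ))) (k, l)
  rw [Module.Basis.tensorProduct_apply, Pi.basisFun_apply, Pi.basisFun_apply] at h
  exact h

theorem ofMatrix_single {C : Type*} [Ring C] [Bialgebra ℂ C] (t : Fin 2 → Fin 2 → C) (h₁) (h₂)
    (k : Fin 2) : (RightComodule.ofMatrix t h₁ h₂).coact (Pi.single k 1)
      = ∑ m, Pi.single m (1 : ℂ) ⊗ₜ[ℂ] t m k := by
  have h := (Pi.basisFun ℂ (Fin 2)).constr_basis ℂ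
    (fun k => ∑ m, Pi.single m (1 : ℂ) ⊗ₜ[ℂ] t m k) k
  rw [Pi.basisFun_apply] at h
  exact h

theorem tensor_coact_tmul {C V W : Type*} [Ring C] [Bialgebra ℂ C] [AddCommGroup V] [Module ℂ V]
    [AddCommGroup W] [Module ℂ W] (ρ : RightComodule C V) (σ : RightComodule C W) (v : V) (w : W) :
    (ρ.tensor σ).coact (v ⊗ₜ[ℂ] w) = (LinearMap.mul' ℂ C).lTensor (V ⊗[ℂ] W)
      (TensorProduct.tensorTensorTensorComm ℂ V C W C (ρ.coact v ⊗ₜ[ℂ] σ.coact w)) := rfl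

theorem external_coact_tmul {C D V W : Type*} [Ring C] [Bialgebra ℂ C] [Ring D] [Bialgebra ℂ D]
    [AddCommGroup V] [Module ℂ V] [AddCommGroup W] [Module ℂ W]
    (ρ : RightComodule C V) (σ : RightComodule D W) (v : V) (w : W) :
    (ρ.external σ).coact (v ⊗ₜ[ℂ] w) =
      TensorProduct.tensorTensorTensorComm ℂ V C W D (ρ.coact v ⊗ₜ[ℂ] σ.coact w) := rfl

/-- The braiding by `r` is colinear once `r` intertwines the matrix of coefficients. -/
theorem braiding_colinear {C : Type*} [Ring C] [Bialgebra ℂ C] (t : Fin 2 → Fin 2 → C) (h₁) (h₂)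
    (r : Fin 2 → Fin 2 → Fin 2 → Fin 2 → ℂ)
    (h : ∀ i j k l, ∑ m, ∑ n, r m k n l • (t i n * t j m) = ∑ m, ∑ n, r j m i n • (t m k * t n l)) :
    IsColinear ((RightComodule.ofMatrix t h₁ h₂).tensor (RightComodule.ofMatrix t h₁ h₂))
      ((RightComodule.ofMatrix t h₁ h₂).tensor (RightComodule.ofMatrix t h₁ h₂)) (braiding r) := by
  unfold IsColinear
  refine ((Pi.basisFun ℂ (Fin 2)).tensorProduct (Pi.basisFun ℂ (Fin 2))).ext fun p => ?_
  obtain ⟨k, l⟩ := p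
  have h00 := h 0 0 k l
  have h01 := h 0 1 k l
  have h10 := h 1 0 k l
  have h11 := h 1 1 k l
  rw [Module.Basis.tensorProduct_apply, Pi.basisFun_apply, Pi.basisFun_apply]
  simp only [LinearMap.comp_apply, braiding_single, tensor_coact_tmul, ofMatrix_single, map_sum,
    map_smul, TensorProduct.sum_tmul, TensorProduct.tmul_sum,
    TensorProduct.tensorTensorTensorComm_tmul, LinearMap.lTensor_tmul, LinearMap.rTensor_tmul,
    LinearMap.mul'_apply]
  trans ∑ i, ∑ j, (Pi.single i (1 : ℂ) ⊗ₜ[ℂ] Pi.single j (1 : ℂ)) ⊗ₜ[ℂ]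
    ∑ m, ∑ n, r m k n l • (t i n * t j m)
  · simp only [Fin.sum_univ_two, TensorProduct.tmul_add, TensorProduct.tmul_smul, smul_add]
    abel
  · simp only [h]
    simp only [Fin.sum_univ_two, TensorProduct.tmul_add, TensorProduct.tmul_smul,
      TensorProduct.add_tmul, ← TensorProduct.smul_tmul']
    abel

variable (q : Param)

/-- The braiding `Ψ` of `V_{1/2}` with itself:
`x⊗x ↦ q^{1/2} x⊗x`, `x⊗y ↦ q^{-1/2}(y⊗x + (q - q⁻¹) x⊗y)`, `y⊗x ↦ q^{-1/2} x⊗y`,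
`y⊗y ↦ q^{1/2} y⊗y`. -/
def Psi : (Fin 2 → ℂ) ⊗[ℂ] (Fin 2 → ℂ) →ₗ[ℂ] (Fin 2 → ℂ) ⊗[ℂ] (Fin 2 → ℂ) :=
  braiding (fun m k n l => zeta q * Rmat q m k n l)

/-- The braiding `Ψ̃` of `Ṽ_{1/2}` with itself; the coquasitriangular structure of the co-opposite
bialgebra is `R₂₁`. -/
def PsiCop : (Fin 2 → ℂ) ⊗[ℂ] (Fin 2 → ℂ) →ₗ[ℂ] (Fin 2 → ℂ) ⊗[ℂ] (Fin 2 → ℂ) :=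
  braiding (fun m k n l => zeta q * Rmat q n l m k)

theorem Psi_colinear : IsColinear ((Vhalf q).tensor (Vhalf q)) ((Vhalf q).tensor (Vhalf q))
    (Psi q) := by
  have hq := qc_ne_zero q
  apply braiding_colinear
  intro i j k l
  fin_cases i <;> fin_cases j <;> fin_cases k <;> fin_cases l <;>
  simp [Rmat, SU.ba, SU.ca, SU.db, SU.dc, SU.cb, SU.ad, SU.da, smul_smul] <;>
  (match_scalars <;> (try field_simp) <;> (try ring))

set_option maxHeartbeats 1000000 in
theorem PsiCop_intertwines (i j k l : Fin 2) :
    ∑ m, ∑ n, (zeta q * Rmat q n l m k) • (SU.Sinva q i n * SU.Sinva q j m)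
      = ∑ m, ∑ n, (zeta q * Rmat q i n j m) • (SU.Sinva q m k * SU.Sinva q n l) := by
  have hq := qc_ne_zero q
  fin_cases i <;> fin_cases j <;> fin_cases k <;> fin_cases l <;>
  simp [SU.Sinva, Rmat, SU.ba, SU.ca, SU.db, SU.dc, SU.cb, SU.ad, SU.da, smul_smul] <;>
  (match_scalars <;> (try field_simp) <;> (try ring))

theorem PsiCop_colinear : IsColinear ((VhalfCop q).tensor (VhalfCop q))
    ((VhalfCop q).tensor (VhalfCop q)) (PsiCop q) := by
  apply braiding_colinear
  intro i j k l
  have h := congrArg (SUcop.of q) (PsiCop_intertwines q i j k l)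
  simpa only [tcop, map_sum, map_smul, map_mul] using h

/-- The underlying space of the comodule `W = Ṽ_{1/2} ⊗ V_{1/2}`. -/
abbrev WSpace : Type := (Fin 2 → ℂ) ⊗[ℂ] (Fin 2 → ℂ)

/-- The comodule `W = Ṽ_{1/2} ⊗ V_{1/2}`. -/
def W : RightComodule (HH q) WSpace := (VhalfCop q).external (Vhalf q)

/-- The braiding `Φ = (id ⊗ σ ⊗ id) ∘ (Ψ̃ ⊗ Ψ) ∘ (id ⊗ σ ⊗ id)` of `W ⊗ W`. -/
def Phi : WSpace ⊗[ℂ] WSpace →ₗ[ℂ] WSpace ⊗[ℂ] WSpace :=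
  (TensorProduct.tensorTensorTensorComm ℂ _ _ _ _).toLinearMap ∘ₗ
    TensorProduct.map (PsiCop q) (Psi q) ∘ₗ
    (TensorProduct.tensorTensorTensorComm ℂ _ _ _ _).toLinearMap

theorem tensor_external {C D V V' W W' : Type*} [Ring C] [Bialgebra ℂ C] [Ring D] [Bialgebra ℂ D]
    [AddCommGroup V] [Module ℂ V] [AddCommGroup V'] [Module ℂ V'] [AddCommGroup W] [Module ℂ W]
    [AddCommGroup W'] [Module ℂ W'] (ρ : RightComodule C V) (ρ' : RightComodule C V')
    (σ : RightComodule D W) (σ' : RightComodule D W') :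
    IsColinear ((ρ.external σ).tensor (ρ'.external σ')) ((ρ.tensor ρ').external (σ.tensor σ'))
      (TensorProduct.tensorTensorTensorComm ℂ V W V' W').toLinearMap := by
  unfold IsColinear
  refine TensorProduct.ext_fourfold' fun v w v' w' => ?_
  simp only [LinearMap.comp_apply, LinearEquiv.coe_coe, TensorProduct.tensorTensorTensorComm_tmul,
    external_coact_tmul, tensor_coact_tmul]
  generalize ρ.coact v = a
  generalize ρ'.coact v' = a'
  generalize σ.coact w = b
  generalize σ'.coact w' = b'
  induction a using TensorProduct.induction_on with
  | zero => simp
  | add x y hx hy => simp only [TensorProduct.add_tmul, map_add, hx, hy]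
  | tmul v c =>
    induction a' using TensorProduct.induction_on with
    | zero => simp
    | add x y hx hy => simp only [TensorProduct.add_tmul, TensorProduct.tmul_add, map_add, hx, hy]
    | tmul v' c' =>
      induction b using TensorProduct.induction_on with
      | zero => simp
      | add x y hx hy =>
        simp only [TensorProduct.add_tmul, TensorProduct.tmul_add, map_add, hx, hy]
      | tmul w d =>
        induction b' using TensorProduct.induction_on with
        | zero => simp
        | add x y hx hy =>
          simp only [TensorProduct.add_tmul, TensorProduct.tmul_add, map_add, hx, hy]
        | tmul w' d' => simp

theorem IsColinear.comp {C U V W : Type*} [Ring C] [Bialgebra ℂ C]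
    [AddCommGroup U] [Module ℂ U] [AddCommGroup V] [Module ℂ V] [AddCommGroup W] [Module ℂ W]
    {ρ : RightComodule C U} {σ : RightComodule C V} {τ : RightComodule C W}
    {f : U →ₗ[ℂ] V} {g : V →ₗ[ℂ] W} (hg : IsColinear σ τ g) (hf : IsColinear ρ σ f) :
    IsColinear ρ τ (g ∘ₗ f) := by
  unfold IsColinear at *
  rw [← LinearMap.comp_assoc, hg, LinearMap.comp_assoc, hf, LinearMap.rTensor_comp,
    LinearMap.comp_assoc]

theorem IsColinear.symm {C V W : Type*} [Ring C] [Bialgebra ℂ C]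
    [AddCommGroup V] [Module ℂ V] [AddCommGroup W] [Module ℂ W]
    {σ : RightComodule C V} {τ : RightComodule C W} {e : V ≃ₗ[ℂ] W}
    (h : IsColinear σ τ e.toLinearMap) : IsColinear τ σ e.symm.toLinearMap := by
  unfold IsColinear at *
  have h1 : e.symm.toLinearMap.rTensor C ∘ₗ e.toLinearMap.rTensor C = LinearMap.id := by
    rw [← LinearMap.rTensor_comp]
    simp
  calc σ.coact ∘ₗ e.symm.toLinearMap
      = (e.symm.toLinearMap.rTensor C ∘ₗ e.toLinearMap.rTensor C) ∘ₗ σ.coact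
          ∘ₗ e.symm.toLinearMap := by rw [h1, LinearMap.id_comp]
    _ = e.symm.toLinearMap.rTensor C ∘ₗ (e.toLinearMap.rTensor C ∘ₗ σ.coact)
          ∘ₗ e.symm.toLinearMap := by simp only [LinearMap.comp_assoc]
    _ = e.symm.toLinearMap.rTensor C ∘ₗ τ.coact := by
      rw [← h, LinearMap.comp_assoc, LinearEquiv.comp_symm, LinearMap.comp_id]

theorem IsColinear.external {C D V V' W W' : Type*} [Ring C] [Bialgebra ℂ C] [Ring D]
    [Bialgebra ℂ D] [AddCommGroup V] [Module ℂ V] [AddCommGroup V'] [Module ℂ V'] [AddCommGroup W]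
    [Module ℂ W] [AddCommGroup W'] [Module ℂ W'] {ρ : RightComodule C V} {ρ' : RightComodule C V'}
    {σ : RightComodule D W} {σ' : RightComodule D W'} {f : V →ₗ[ℂ] V'} {g : W →ₗ[ℂ] W'}
    (hf : IsColinear ρ ρ' f) (hg : IsColinear σ σ' g) :
    IsColinear (ρ.external σ) (ρ'.external σ') (TensorProduct.map f g) := by
  refine TensorProduct.ext' fun v w => ?_
  have h1 := LinearMap.congr_fun hf v
  have h2 := LinearMap.congr_fun hg w
  simp only [LinearMap.comp_apply] at h1 h2
  simp only [LinearMap.comp_apply, TensorProduct.map_tmul, external_coact_tmul, h1, h2]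
  generalize ρ.coact v = a
  generalize σ.coact w = b
  induction a using TensorProduct.induction_on with
  | zero => simp
  | add x y hx hy => simp only [TensorProduct.add_tmul, map_add, hx, hy]
  | tmul v c =>
    induction b using TensorProduct.induction_on with
    | zero => simp
    | add x y hx hy => simp only [TensorProduct.tmul_add, map_add, hx, hy]
    | tmul w d => simp

theorem Phi_colinear : IsColinear ((W q).tensor (W q)) ((W q).tensor (W q)) (Phi q) := by
  have h := tensor_external (VhalfCop q) (VhalfCop q) (Vhalf q) (Vhalf q)
  have h' := h.symm
  rw [TensorProduct.tensorTensorTensorComm_symm] at h'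
  exact h'.comp (((PsiCop_colinear q).external (Psi_colinear q)).comp h)

/-- The space `W^{∧2}` of `q`-antisymmetric tensors: the eigenspace of `Φ` for the
eigenvalue `-q⁻¹`. -/
def Lambda2Space : Submodule ℂ (WSpace ⊗[ℂ] WSpace) :=
  Module.End.eigenspace (M := WSpace ⊗[ℂ] WSpace) (Phi q) (-(qc q)⁻¹)

instance : AddCommGroup (Lambda2Space q) :=
  Submodule.addCommGroup (R := ℂ) (M := WSpace ⊗[ℂ] WSpace) (Lambda2Space q)

/-- The comodule `W^{∧2}` of `q`-antisymmetric tensors, a subcomodule of `W ⊗ W`. -/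
def Lambda2 : RightComodule (HH q) (Lambda2Space q) :=
  ((W q).tensor (W q)).sub _ ((Phi_colinear q).isSub_eigenspace _)

/-- The underlying space of `Ṽ_{m/2} ⊗ V_{n/2}`. -/
abbrev SpinSpace (m n : ℕ) : Type := QPlane.deg (qc q)⁻¹ m ⊗[ℂ] QPlane.deg (qc q) n

/-- The comodule `Ṽ_{m/2} ⊗ V_{n/2}`. -/
def Spin (m n : ℕ) : RightComodule (HH q) (SpinSpace q m n) := (Vcop q m).external (V q n)

/-! ### Associated bundles and their bimodule structure -/

section bundles

variable {K P X Y Z : Type*} [Ring K] [Bialgebra ℂ K] [Ring P] [Algebra ℂ P] [AddCommGroup X]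
  [Module ℂ X] [AddCommGroup Y] [Module ℂ Y] [AddCommGroup Z] [Module ℂ Z]

/-- The associated bundle `M(X) = (P ⊗ X)^K`: the coinvariant elements of `P ⊗ X`. -/
def assocBundle (δ : ComoduleAlgebra K P) (ρ : RightComodule K X) : Submodule ℂ (P ⊗[ℂ] X) where
  carrier := {z | (δ.toRightComodule.tensor ρ).coact z = z ⊗ₜ[ℂ] 1}
  add_mem' := by
    intro x y hx hy
    simp only [Set.mem_ofPred_eq] at hx hy ⊢
    rw [map_add, hx, hy, TensorProduct.add_tmul]
  zero_mem' := by simp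
  smul_mem' := by
    intro c x hx
    simp only [Set.mem_ofPred_eq] at hx ⊢
    rw [map_smul, hx, TensorProduct.smul_tmul']

/-- Left multiplication `m · (p ⊗ x) = m p ⊗ x`. -/
def lact (m : P) : P ⊗[ℂ] X →ₗ[ℂ] P ⊗[ℂ] X := (LinearMap.mulLeft ℂ m).rTensor X

/-- Right multiplication `(p ⊗ x) · m = p m ⊗ x`. -/
def ract (m : P) : P ⊗[ℂ] X →ₗ[ℂ] P ⊗[ℂ] X := (LinearMap.mulRight ℂ m).rTensor X

/-- `Ω ⊆ P ⊗ X` is an `M`-sub-bimodule. -/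
structure IsBimodule (M : Subalgebra ℂ P) (Ω : Submodule ℂ (P ⊗[ℂ] X)) : Prop where
  lact_mem : ∀ m : M, ∀ ω ∈ Ω, lact (m : P) ω ∈ Ω
  ract_mem : ∀ m : M, ∀ ω ∈ Ω, ract (m : P) ω ∈ Ω

/-- The left action of `M` on a sub-bimodule. -/
def IsBimodule.left {M : Subalgebra ℂ P} {Ω : Submodule ℂ (P ⊗[ℂ] X)} (h : IsBimodule M Ω)
    (m : M) : Ω →ₗ[ℂ] Ω := (lact (m : P)).restrict (h.lact_mem m)

/-- The right action of `M` on a sub-bimodule. -/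
def IsBimodule.right {M : Subalgebra ℂ P} {Ω : Submodule ℂ (P ⊗[ℂ] X)} (h : IsBimodule M Ω)
    (m : M) : Ω →ₗ[ℂ] Ω := (ract (m : P)).restrict (h.ract_mem m)

/-- `Ω`, `Ω₁`, `Ω₂` are `M`-bimodules and `p ⊗ x ↦ (p ⊗ θ₁ x, p ⊗ θ₂ x)` is an isomorphism of
`M`-bimodules `Ω ≃ Ω₁ ⊕ Ω₂`. -/
def BimoduleSplits (M : Subalgebra ℂ P) (Ω : Submodule ℂ (P ⊗[ℂ] X)) (Ω₁ : Submodule ℂ (P ⊗[ℂ] Y))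
    (Ω₂ : Submodule ℂ (P ⊗[ℂ] Z)) (θ₁ : X →ₗ[ℂ] Y) (θ₂ : X →ₗ[ℂ] Z) : Prop :=
  ∃ (h : IsBimodule M Ω) (h₁ : IsBimodule M Ω₁) (h₂ : IsBimodule M Ω₂) (e : Ω ≃ₗ[ℂ] Ω₁ × Ω₂),
    (∀ ω : Ω, ((e ω).1 : P ⊗[ℂ] Y) = θ₁.lTensor P ω ∧ ((e ω).2 : P ⊗[ℂ] Z) = θ₂.lTensor P ω) ∧
    (∀ (m : M) (ω : Ω), e (h.left m ω) = (h₁.left m (e ω).1, h₂.left m (e ω).2)) ∧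
    (∀ (m : M) (ω : Ω), e (h.right m ω) = (h₁.right m (e ω).1, h₂.right m (e ω).2))

end bundles

/-! ### The quantum group `Sp_q(2)` and the quantum four-sphere -/

/-- The free algebra on the entries `A_(r,i)^(s,j)` of the `4 × 4` matrix
`A = ((a, b), (c, d))` of `2 × 2` blocks; `r, s` label the block, `i, j` the entry in it. -/
abbrev SpFree : Type := FreeAlgebra ℂ ((Fin 2 × Fin 2) × (Fin 2 × Fin 2))

/-- The generator `A_x^y`. -/
def SpFree.A (x y : Fin 2 × Fin 2) : SpFree := FreeAlgebra.ι ℂ (x, y)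

/-- The generator `a_i^j`. -/
def SpFree.a (i j : Fin 2) : SpFree := SpFree.A (0, i) (0, j)

/-- The generator `b_i^j`. -/
def SpFree.b (i j : Fin 2) : SpFree := SpFree.A (0, i) (1, j)

/-- The generator `c_i^j`. -/
def SpFree.c (i j : Fin 2) : SpFree := SpFree.A (1, i) (0, j)

/-- The generator `d_i^j`. -/
def SpFree.d (i j : Fin 2) : SpFree := SpFree.A (1, i) (1, j)

/-- The adjoint of a generator: in every block `(m_i^j) = ((m₁, -q m₂^*), (m₂, m₁^*))`. -/
def SpFree.adj (x y : Fin 2 × Fin 2) : SpFree :=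
  if x.2 = y.2 then SpFree.A (x.1, x.2.rev) (y.1, y.2.rev)
  else if x.2 = 0 then -qc q • SpFree.A (x.1, 1) (y.1, 0)
  else -(qc q)⁻¹ • SpFree.A (x.1, 0) (y.1, 1)

/-- The linear anti-homomorphism extending `SpFree.adj`. It agrees with the involution `*` on
elements with real coefficients, hence on all differences of the relations below. -/
def SpFree.dag (x : SpFree) : SpFree :=
  MulOpposite.unop
    (FreeAlgebra.lift ℂ (fun p => MulOpposite.op (SpFree.adj q p.1 p.2)) x : SpFreeᵐᵒᵖ)

open SpFree in
/-- The defining relations of `A[Sp_q(2)]`; `star` closes them under the involution. -/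
inductive SpRel : SpFree → SpFree → Prop
  | aa (i j k l) : SpRel (∑ α, ∑ β, Rmat q i α k β • (a α j * a β l))
      (∑ α, ∑ β, Rmat q α j β l • (a k β * a i α))
  | bb (i j k l) : SpRel (∑ α, ∑ β, Rmat q i α k β • (b α j * b β l))
      (∑ α, ∑ β, Rmat q α j β l • (b k β * b i α))
  | cc (i j k l) : SpRel (∑ α, ∑ β, Rmat q i α k β • (c α j * c β l))
      (∑ α, ∑ β, Rmat q α j β l • (c k β * c i α))
  | dd (i j k l) : SpRel (∑ α, ∑ β, Rmat q i α k β • (d α j * d β l))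
      (∑ α, ∑ β, Rmat q α j β l • (d k β * d i α))
  | ba (i j k) : SpRel (b i 0 * a k j) (zeta q • ∑ α, ∑ β, Rmat q k α i β • (a α j * b β 0))
  | ab (i j k) : SpRel (a i j * b k 1) (zeta q • ∑ α, ∑ β, Rmat q k α i β • (b α 1 * a β j))
  | ac (i k m) : SpRel (a 0 i * c m k) (zeta q • ∑ α, ∑ β, Rmat q α i β k • (c m β * a 0 α))
  | ca (i k m) : SpRel (c m i * a 1 k) (zeta q • ∑ α, ∑ β, Rmat q α i β k • (a 1 β * c m α))
  | bd (i k m) : SpRel (b 0 i * d m k) (zeta q • ∑ α, ∑ β, Rmat q α i β k • (d m β * b 0 α))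
  | db (i k m) : SpRel (d m i * b 1 k) (zeta q • ∑ α, ∑ β, Rmat q α i β k • (b 1 β * d m α))
  | dc (i j k) : SpRel (d i 0 * c k j) (zeta q • ∑ α, ∑ β, Rmat q k α i β • (c α j * d β 0))
  | cd (i j k) : SpRel (c i j * d k 1) (zeta q • ∑ α, ∑ β, Rmat q k α i β • (d α 1 * c β j))
  | cb₁ (i j) : SpRel (c 0 j * b i 0) (zeta q ^ 2 • (b i 0 * c 0 j))
  | cb₂ (i j) : SpRel (c 1 j * b i 1) ((zeta q ^ 2)⁻¹ • (b i 1 * c 1 j))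
  | cb₃ (i j) : SpRel (c 0 j * b i 1 - b i 1 * c 0 j)
      ((zeta q * (qc q - (qc q)⁻¹)) • (a i j * d 0 1))
  | cb₄ (i j) : SpRel (c 1 j * b i 0 - b i 0 * c 1 j)
      ((zeta q * (qc q - (qc q)⁻¹)) • (d 1 0 * a i j))
  | da₁ (i j) : SpRel (d 0 0 * a i j - a i j * d 0 0)
      ((zeta q * (qc q - (qc q)⁻¹)) • (b i 0 * c 0 j))
  | da₂ (i j) : SpRel (a i j * d 1 1 - d 1 1 * a i j)
      ((zeta q * (qc q - (qc q)⁻¹)) • (c 1 j * b i 1))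
  | da₃ (i j) : SpRel (d 0 1 * a i j) (zeta q ^ 2 • (a i j * d 0 1))
  | da₄ (i j) : SpRel (d 1 0 * a i j) ((zeta q ^ 2)⁻¹ • (a i j * d 1 0))
  | unitary₁ (y z) : SpRel (∑ x, adj q x y * A x z) (if y = z then 1 else 0)
  | unitary₂ (x z) : SpRel (∑ y, A x y * adj q z y) (if x = z then 1 else 0)
  | star (x y) : SpRel x y → SpRel (dag q x) (dag q y)

/-- The coordinate algebra `P = A[Sp_q(2)]`. -/
def Sp : Type := RingQuot (SpRel q)

instance : Ring (Sp q) := inferInstanceAs (Ring (RingQuot (SpRel q)))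

instance : Algebra ℂ (Sp q) := inferInstanceAs (Algebra ℂ (RingQuot (SpRel q)))

/-- The quotient map onto `A[Sp_q(2)]`. -/
def Sp.mk : SpFree →ₐ[ℂ] Sp q := RingQuot.mkAlgHom ℂ (SpRel q)

/-- The element `S(u_i^j)` of `A[SU_q(2)]`, where `u = w a w⁻¹` with `w = ((0, 1), (-1, 0))`. -/
def SU.Su (i j : Fin 2) : SU q :=
  if i = j then SU.Sa q i.rev j.rev else -SU.Sa q i.rev j.rev

/-- The elements of `A[SU_q^cop(2)] ⊗ A[SU_q(2)]` by which the rows of `A` transform: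
`a_i^j ⊗ 1` in the upper rows and `1 ⊗ S(u_i^j)` in the lower rows. -/
def rowMat (r i j : Fin 2) : HH q :=
  if r = 0 then SUcop.of q (SU.a q i j) ⊗ₜ[ℂ] 1 else 1 ⊗ₜ[ℂ] SU.Su q i j

theorem SU.comul_Su (i j : Fin 2) :
    Coalgebra.comul (R := ℂ) (SU.Su q i j) = ∑ m, SU.Su q m j ⊗ₜ[ℂ] SU.Su q i m := by
  have hq := qc_ne_zero q
  fin_cases i <;> fin_cases j <;>
  simp [SU.Su, SU.Sa, SU.comul_a, TensorProduct.tmul_smul, TensorProduct.tmul_neg,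
    TensorProduct.neg_tmul, ← TensorProduct.smul_tmul', smul_smul, hq]

theorem SU.counit_Su (i j : Fin 2) :
    Coalgebra.counit (R := ℂ) (SU.Su q i j) = if i = j then 1 else 0 := by
  fin_cases i <;> fin_cases j <;> simp [SU.Su, SU.Sa, SU.counit_a]

theorem comul_rowMat (r i j : Fin 2) :
    Coalgebra.comul (R := ℂ) (rowMat q r i j) = ∑ m, rowMat q r m j ⊗ₜ[ℂ] rowMat q r i m := by
  fin_cases r <;>
  simp [rowMat, TensorProduct.comul_tmul, SUcop.comul_a, SU.comul_Su, Bialgebra.comul_one,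
    Algebra.TensorProduct.one_def, TensorProduct.add_tmul, TensorProduct.tmul_add]

theorem counit_rowMat (r i j : Fin 2) :
    Coalgebra.counit (R := ℂ) (rowMat q r i j) = if i = j then 1 else 0 := by
  fin_cases r <;>
  simp [rowMat, TensorProduct.counit_tmul, SUcop.counit_a, SU.counit_Su, Bialgebra.counit_one]

/-- The coaction of `A[SU_q^cop(2)] ⊗ A[SU_q(2)]` on the generators of `A[Sp_q(2)]`, extended
multiplicatively:
`a_i^j ↦ a_m^j ⊗ a_i^m`, `b_i^j ↦ b_m^j ⊗ a_i^m`, `c_i^j ↦ c_m^j ⊗ S(u_i^m)`,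
`d_i^j ↦ d_m^j ⊗ S(u_i^m)`. -/
def SpFree.comodule : ComoduleAlgebra (HH q) SpFree :=
  ComoduleAlgebra.ofAlgHom
    (FreeAlgebra.lift ℂ (fun p => ∑ m, SpFree.A (p.1.1, m) p.2 ⊗ₜ[ℂ] rowMat q p.1.1 p.1.2 m))
    (by
      apply FreeAlgebra.hom_ext
      funext p
      simp [SpFree.A, comul_rowMat, TensorProduct.tmul_add, TensorProduct.add_tmul]
      abel)
    (by
      apply FreeAlgebra.hom_ext
      funext p
      obtain ⟨⟨r, i⟩, s⟩ := p
      fin_cases i <;> simp [SpFree.A, counit_rowMat])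

/-- The coordinate algebra `A[S⁴_q]`: the coinvariant elements of `A[Sp_q(2)]`, that is, those
represented by coinvariant polynomials in the generators. -/
def S4 : Subalgebra ℂ (Sp q) := (SpFree.comodule q).coinvariants.map (Sp.mk q)

/-- The bundle over `S⁴_q` associated with the comodule `X`: the coinvariant elements of
`A[Sp_q(2)] ⊗ X`, that is, those represented by coinvariant polynomials in the generators with
coefficients in `X`. -/
def S4bundle {X : Type*} [AddCommGroup X] [Module ℂ X] (ρ : RightComodule (HH q) X) :
    Submodule ℂ (Sp q ⊗[ℂ] X) :=
  (assocBundle (SpFree.comodule q) ρ).map ((Sp.mk q).toLinearMap.rTensor X)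

/-- The bimodule `Ω²S⁴_q` of two-forms. -/
def Omega2 : Submodule ℂ (Sp q ⊗[ℂ] Lambda2Space q) := S4bundle q (Lambda2 q)

/-- The bimodule `Ω²₊S⁴_q` of self-dual two-forms. -/
def Omega2Plus : Submodule ℂ (Sp q ⊗[ℂ] SpinSpace q 2 0) := S4bundle q (Spin q 2 0)

/-- The bimodule `Ω²₋S⁴_q` of anti-self-dual two-forms. -/
def Omega2Minus : Submodule ℂ (Sp q ⊗[ℂ] SpinSpace q 0 2) := S4bundle q (Spin q 0 2)

end QSphere

end

universe u

set_option linter.unnecessarySeqFocus false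

noncomputable section

/-! The braidings `Psi` and `PsiCop` are diagonalisable with the same two eigenvalues, α = ζq on a
space of dimension three and β = -ζq⁻¹ on a line. The α-eigenspace is carried isomorphically onto
the quadratic polynomials by multiplication in the quantum plane, the β-eigenspace onto the
constants by the invariant form that encodes the quantum determinant. After reordering the tensor
factors `Phi` is `PsiCop` ⊗ `Psi`, with eigenvalues α², αβ, β². Since ζ² = q⁻¹, the value -q⁻¹ is
αβ, and it differs from the other two because q² ≠ -1. So the antisymmetric tensors are exactly the
mixed part, (symmetric ⊗ alternating) ⊕ (alternating ⊗ symmetric), of dimension 3·1 + 1·3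
(`EigenSplit.map_apply_eq_self`, `iota_theta`).

The projections θ₊, θ₋ onto the two summands are tensor products of multiplication and form, hence
colinear: the coaction on a quantum plane is multiplicative, and the form is invariant. Their
sections are then colinear automatically (`IsColinear.of_biprod`).

A colinear map of coefficients, tensored with the identity of P, preserves coinvariants and commutes
with multiplication on P. Hence the splitting of the coefficients passes to associated bundles, with
explicit inverse (`BimoduleSplits.of_biprod`). For the four-sphere the same maps are first applied
over the free algebra and then pushed through the quotient map, with which they commute. -/

namespace QSphere

/-! ### Colinear maps into subcomodules and out of direct summands. -/

section comodules

variable {C X Y Z : Type*} [Ring C] [Bialgebra ℂ C] [AddCommGroup X] [Module ℂ X]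
  [AddCommGroup Y] [Module ℂ Y] [AddCommGroup Z] [Module ℂ Z]

theorem RightComodule.subtype_colinear (ρ : RightComodule C X) (U : Submodule ℂ X)
    (h : ∀ u ∈ U, ρ.coact u ∈ LinearMap.range (U.subtype.rTensor C)) :
    IsColinear (ρ.sub U h) ρ U.subtype := by
  ext u
  exact (congrArg Subtype.val (LinearEquiv.apply_symm_apply
    (LinearEquiv.ofInjective (U.subtype.rTensor C)
    (Module.Flat.rTensor_preserves_injective_linearMap _ U.injective_subtype))
    ⟨ρ.coact u, h u u.2⟩)).symm

/-- Colinearity of a map into a subcomodule may be tested in the ambient comodule. -/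
theorem IsColinear.of_subtype_comp {ρ : RightComodule C X} {σ : RightComodule C Y}
    {U : Submodule ℂ X} (h : ∀ u ∈ U, ρ.coact u ∈ LinearMap.range (U.subtype.rTensor C))
    {f : Y →ₗ[ℂ] U} (hf : IsColinear σ ρ (U.subtype ∘ₗ f)) : IsColinear σ (ρ.sub U h) f := by
  -- Over a field C is flat, so U ⊗ C embeds in X ⊗ C and the identity may be checked there.
  have inj : Function.Injective (U.subtype.rTensor C) :=
    Module.Flat.rTensor_preserves_injective_linearMap _ U.injective_subtype
  refine LinearMap.cancel_left inj |>.1 ?_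
  rw [← LinearMap.comp_assoc, ← RightComodule.subtype_colinear ρ U h, LinearMap.comp_assoc, hf,
    LinearMap.rTensor_comp, LinearMap.comp_assoc]

/-- The inclusion of a summand is colinear if the projections are. -/
theorem IsColinear.of_biprod {ρ : RightComodule C X} {σ : RightComodule C Y}
    {τ : RightComodule C Z} {p₁ : X →ₗ[ℂ] Y} {p₂ : X →ₗ[ℂ] Z} {i₁ : Y →ₗ[ℂ] X} {i₂ : Z →ₗ[ℂ] X}
    (h₁ : IsColinear ρ σ p₁) (h₂ : IsColinear ρ τ p₂) (hid : i₁ ∘ₗ p₁ + i₂ ∘ₗ p₂ = LinearMap.id)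
    (h11 : p₁ ∘ₗ i₁ = LinearMap.id) (h21 : p₂ ∘ₗ i₁ = 0) : IsColinear σ ρ i₁ := by
  unfold IsColinear at *
  calc ρ.coact ∘ₗ i₁
      -- With the identity of X resolved into the two summands, colinearity of the projections moves
      -- the coaction past them; then p₁i₁ = id gives the wanted term and p₂i₁ = 0 kills the other.
      = (i₁ ∘ₗ p₁ + i₂ ∘ₗ p₂).rTensor C ∘ₗ ρ.coact ∘ₗ i₁ := by
        rw [hid, LinearMap.rTensor_id, LinearMap.id_comp]
    _ = i₁.rTensor C ∘ₗ (p₁.rTensor C ∘ₗ ρ.coact) ∘ₗ i₁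
          + i₂.rTensor C ∘ₗ (p₂.rTensor C ∘ₗ ρ.coact) ∘ₗ i₁ := by
        simp only [LinearMap.rTensor_add, LinearMap.rTensor_comp, LinearMap.add_comp,
          LinearMap.comp_assoc]
    _ = i₁.rTensor C ∘ₗ σ.coact := by
        rw [← h₁, ← h₂, LinearMap.comp_assoc, LinearMap.comp_assoc, h11, h21,
          LinearMap.comp_id, LinearMap.comp_zero, LinearMap.comp_zero, add_zero]

end comodules

/-! ### Associated bundles: functoriality in the coefficients, and the bimodule structure. -/

section bundles

variable {K A P X Y Z : Type*} [Ring K] [Bialgebra ℂ K] [Ring A] [Algebra ℂ A] [Ring P]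
  [Algebra ℂ P] [AddCommGroup X] [Module ℂ X] [AddCommGroup Y] [Module ℂ Y] [AddCommGroup Z]
  [Module ℂ Z]

theorem IsColinear.lTensor {ρ : RightComodule K X} {σ : RightComodule K Y} {θ : X →ₗ[ℂ] Y}
    (h : IsColinear ρ σ θ) (δ : ComoduleAlgebra K P) :
    IsColinear (δ.toRightComodule.tensor ρ) (δ.toRightComodule.tensor σ) (θ.lTensor P) := by
  refine TensorProduct.ext' fun p x => ?_
  have h' := LinearMap.congr_fun h x
  simp only [LinearMap.comp_apply] at h'
  simp only [LinearMap.comp_apply, LinearMap.lTensor_tmul, tensor_coact_tmul, h']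
  -- Beyond colinearity of θ only bilinearity in the two coaction values matters, so both become
  -- arbitrary tensors and pure tensors suffice. The same device serves the next two coaction
  -- lemmas.
  generalize δ.coact p = s
  generalize ρ.coact x = t
  induction s using TensorProduct.induction_on with
  | zero => simp
  | add x y hx hy => simp only [TensorProduct.add_tmul, map_add, hx, hy]
  | tmul v c =>
    induction t using TensorProduct.induction_on with
    | zero => simp
    | add x y hx hy => simp only [TensorProduct.tmul_add, map_add, hx, hy]
    | tmul w d => simp

theorem lTensor_mem_assocBundle {ρ : RightComodule K X} {σ : RightComodule K Y} {θ : X →ₗ[ℂ] Y}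
    (h : IsColinear ρ σ θ) (δ : ComoduleAlgebra K P) {z : P ⊗[ℂ] X}
    (hz : z ∈ assocBundle δ ρ) : θ.lTensor P z ∈ assocBundle δ σ := by
  have h' := LinearMap.congr_fun (h.lTensor δ) z
  simp only [LinearMap.comp_apply] at h'
  change (δ.toRightComodule.tensor ρ).coact z = z ⊗ₜ[ℂ] 1 at hz
  change (δ.toRightComodule.tensor σ).coact (θ.lTensor P z) = θ.lTensor P z ⊗ₜ[ℂ] 1
  rw [h', hz, LinearMap.rTensor_tmul]

/-- Coinvariance of m gives δ(mp) = (m ⊗ 1)δ(p), so m does not touch the K-component. -/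
theorem tensor_coact_lact (δ : ComoduleAlgebra K P) (ρ : RightComodule K X)
    (m : δ.coinvariants) (z : P ⊗[ℂ] X) :
    (δ.toRightComodule.tensor ρ).coact (lact (m : P) z)
      = (lact (m : P)).rTensor K ((δ.toRightComodule.tensor ρ).coact z) := by
  have hm : δ.coact (m : P) = (m : P) ⊗ₜ[ℂ] 1 := m.2
  induction z using TensorProduct.induction_on with
  | zero => simp
  | add x y hx hy => simp only [map_add, hx, hy]
  | tmul p x =>
    simp only [lact, LinearMap.rTensor_tmul, LinearMap.mulLeft_apply, tensor_coact_tmul,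
      δ.coact_mul, hm]
    generalize δ.coact p = s
    generalize ρ.coact x = t
    induction s using TensorProduct.induction_on with
    | zero => simp
    | add x y hx hy => simp only [mul_add, TensorProduct.add_tmul, map_add, hx, hy]
    | tmul v c =>
      induction t using TensorProduct.induction_on with
      | zero => simp
      | add x y hx hy => simp only [TensorProduct.tmul_add, map_add, hx, hy]
      | tmul w d => simp

/-- On this side the K-component of m stands between those of p and x; since it is 1, the
noncommutativity of K causes no trouble. -/
theorem tensor_coact_ract (δ : ComoduleAlgebra K P) (ρ : RightComodule K X)
    (m : δ.coinvariants) (z : P ⊗[ℂ] X) :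
    (δ.toRightComodule.tensor ρ).coact (ract (m : P) z)
      = (ract (m : P)).rTensor K ((δ.toRightComodule.tensor ρ).coact z) := by
  have hm : δ.coact (m : P) = (m : P) ⊗ₜ[ℂ] 1 := m.2
  induction z using TensorProduct.induction_on with
  | zero => simp
  | add x y hx hy => simp only [map_add, hx, hy]
  | tmul p x =>
    simp only [ract, LinearMap.rTensor_tmul, LinearMap.mulRight_apply, tensor_coact_tmul,
      δ.coact_mul, hm]
    generalize δ.coact p = s
    generalize ρ.coact x = t
    induction s using TensorProduct.induction_on with
    | zero => simp
    | add x y hx hy => simp only [add_mul, TensorProduct.add_tmul, map_add, hx, hy]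
    | tmul v c =>
      induction t using TensorProduct.induction_on with
      | zero => simp
      | add x y hx hy => simp only [TensorProduct.tmul_add, map_add, hx, hy]
      | tmul w d => simp

theorem assocBundle_isBimodule (δ : ComoduleAlgebra K P) (ρ : RightComodule K X) :
    IsBimodule δ.coinvariants (assocBundle δ ρ) where
  lact_mem m z hz := by
    change (δ.toRightComodule.tensor ρ).coact z = z ⊗ₜ[ℂ] 1 at hz
    change (δ.toRightComodule.tensor ρ).coact (lact (m : P) z) = lact (m : P) z ⊗ₜ[ℂ] 1
    rw [tensor_coact_lact, hz, LinearMap.rTensor_tmul]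
  ract_mem m z hz := by
    change (δ.toRightComodule.tensor ρ).coact z = z ⊗ₜ[ℂ] 1 at hz
    change (δ.toRightComodule.tensor ρ).coact (ract (m : P) z) = ract (m : P) z ⊗ₜ[ℂ] 1
    rw [tensor_coact_ract, hz, LinearMap.rTensor_tmul]

theorem rTensor_lact (π : A →ₐ[ℂ] P) (m : A) (z : A ⊗[ℂ] X) :
    π.toLinearMap.rTensor X (lact m z) = lact (π m) (π.toLinearMap.rTensor X z) := by
  induction z using TensorProduct.induction_on with
  | zero => simp
  | add x y hx hy => simp only [map_add, hx, hy]
  | tmul p x => simp [lact]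

theorem rTensor_ract (π : A →ₐ[ℂ] P) (m : A) (z : A ⊗[ℂ] X) :
    π.toLinearMap.rTensor X (ract m z) = ract (π m) (π.toLinearMap.rTensor X z) := by
  induction z using TensorProduct.induction_on with
  | zero => simp
  | add x y hx hy => simp only [map_add, hx, hy]
  | tmul p x => simp [ract]

/-- The image of a sub-bimodule under an algebra map is a sub-bimodule. -/
theorem IsBimodule.map {M : Subalgebra ℂ A} {Ω : Submodule ℂ (A ⊗[ℂ] X)} (h : IsBimodule M Ω)
    (π : A →ₐ[ℂ] P) : IsBimodule (M.map π) (Ω.map (π.toLinearMap.rTensor X)) where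
  lact_mem := by
    rintro ⟨_, m, hm, rfl⟩ _ ⟨z, hz, rfl⟩
    exact ⟨lact m z, h.lact_mem ⟨m, hm⟩ z hz, rTensor_lact π m z⟩
  ract_mem := by
    rintro ⟨_, m, hm, rfl⟩ _ ⟨z, hz, rfl⟩
    exact ⟨ract m z, h.ract_mem ⟨m, hm⟩ z hz, rTensor_ract π m z⟩

theorem lTensor_lact (θ : X →ₗ[ℂ] Y) (m : P) (z : P ⊗[ℂ] X) :
    θ.lTensor P (lact m z) = lact m (θ.lTensor P z) := by
  simp only [lact, ← LinearMap.comp_apply, LinearMap.lTensor_comp_rTensor,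
    LinearMap.rTensor_comp_lTensor]

theorem lTensor_ract (θ : X →ₗ[ℂ] Y) (m : P) (z : P ⊗[ℂ] X) :
    θ.lTensor P (ract m z) = ract m (θ.lTensor P z) := by
  simp only [ract, ← LinearMap.comp_apply, LinearMap.lTensor_comp_rTensor,
    LinearMap.rTensor_comp_lTensor]

/-- A decomposition of the coefficients that respects the sub-bimodules splits them. -/
theorem BimoduleSplits.of_biprod {M : Subalgebra ℂ P} {Ω : Submodule ℂ (P ⊗[ℂ] X)}
    {Ω₁ : Submodule ℂ (P ⊗[ℂ] Y)} {Ω₂ : Submodule ℂ (P ⊗[ℂ] Z)}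
    (h : IsBimodule M Ω) (h₁ : IsBimodule M Ω₁) (h₂ : IsBimodule M Ω₂)
    {p₁ : X →ₗ[ℂ] Y} {p₂ : X →ₗ[ℂ] Z} {i₁ : Y →ₗ[ℂ] X} {i₂ : Z →ₗ[ℂ] X}
    (hid : i₁ ∘ₗ p₁ + i₂ ∘ₗ p₂ = LinearMap.id)
    (h11 : p₁ ∘ₗ i₁ = LinearMap.id) (h21 : p₂ ∘ₗ i₁ = 0)
    (h22 : p₂ ∘ₗ i₂ = LinearMap.id) (h12 : p₁ ∘ₗ i₂ = 0)
    (hp₁ : ∀ z ∈ Ω, p₁.lTensor P z ∈ Ω₁) (hp₂ : ∀ z ∈ Ω, p₂.lTensor P z ∈ Ω₂)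
    (hi₁ : ∀ z ∈ Ω₁, i₁.lTensor P z ∈ Ω) (hi₂ : ∀ z ∈ Ω₂, i₂.lTensor P z ∈ Ω) :
    BimoduleSplits M Ω Ω₁ Ω₂ p₁ p₂ := by
  -- The inverse is given by the sections themselves, restricted to the sub-bimodules, so no
  -- exactness of passing to coinvariants is needed.
  refine ⟨h, h₁, h₂, LinearEquiv.ofLinearMap
    (((p₁.lTensor P).restrict hp₁).prod ((p₂.lTensor P).restrict hp₂))
    (((i₁.lTensor P).restrict hi₁).coprod ((i₂.lTensor P).restrict hi₂)) ?_ ?_,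
    fun ω => ⟨rfl, rfl⟩, fun m ω => ?_, fun m ω => ?_⟩
  · refine LinearMap.ext fun w => Prod.ext (Subtype.ext ?_) (Subtype.ext ?_)
    · change p₁.lTensor P (i₁.lTensor P w.1 + i₂.lTensor P w.2) = w.1
      simp [map_add, ← LinearMap.comp_apply, ← LinearMap.lTensor_comp, h11, h12]
    · change p₂.lTensor P (i₁.lTensor P w.1 + i₂.lTensor P w.2) = w.2
      simp [map_add, ← LinearMap.comp_apply, ← LinearMap.lTensor_comp, h21, h22]
  · refine LinearMap.ext fun w => Subtype.ext ?_
    change i₁.lTensor P (p₁.lTensor P w) + i₂.lTensor P (p₂.lTensor P w) = w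
    rw [← LinearMap.comp_apply, ← LinearMap.comp_apply, ← LinearMap.lTensor_comp,
      ← LinearMap.lTensor_comp, ← LinearMap.add_apply, ← LinearMap.lTensor_add, hid,
      LinearMap.lTensor_id, LinearMap.id_apply]
  · exact Prod.ext (Subtype.ext (lTensor_lact p₁ (m : P) ω)) (Subtype.ext (lTensor_lact p₂ (m : P) ω))
  · exact Prod.ext (Subtype.ext (lTensor_ract p₁ (m : P) ω)) (Subtype.ext (lTensor_ract p₂ (m : P) ω))

/-- The maps π ⊗ id and id ⊗ θ act on different factors and commute. This carries membership from
the free algebra to its quotient. -/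
theorem lTensor_mem_map {Ω : Submodule ℂ (A ⊗[ℂ] X)} {Ω' : Submodule ℂ (A ⊗[ℂ] Y)}
    {θ : X →ₗ[ℂ] Y} (h : ∀ z ∈ Ω, θ.lTensor A z ∈ Ω') (π : A →ₐ[ℂ] P) :
    ∀ z ∈ Ω.map (π.toLinearMap.rTensor X),
      θ.lTensor P z ∈ Ω'.map (π.toLinearMap.rTensor Y) := by
  rintro _ ⟨z, hz, rfl⟩
  refine ⟨θ.lTensor A z, h z hz, ?_⟩
  simp only [← LinearMap.comp_apply, LinearMap.lTensor_comp_rTensor,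
    LinearMap.rTensor_comp_lTensor]

end bundles

/-! ### The square of the fundamental comodule -/

/-- The space `ℂ² ⊗ ℂ²`. -/
abbrev Sq : Type := (Fin 2 → ℂ) ⊗[ℂ] (Fin 2 → ℂ)

/-- The basis vector `e_k ⊗ e_l` of `ℂ² ⊗ ℂ²`. -/
def ee (k l : Fin 2) : Sq := Pi.single k 1 ⊗ₜ[ℂ] Pi.single l 1

/-- The linear map out of `ℂ² ⊗ ℂ²` with prescribed values on the basis. -/
def Sq.constr {X : Type*} [AddCommGroup X] [Module ℂ X] (f : Fin 2 → Fin 2 → X) : Sq →ₗ[ℂ] X :=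
  ((Pi.basisFun ℂ (Fin 2)).tensorProduct (Pi.basisFun ℂ (Fin 2))).constr ℂ (fun p => f p.1 p.2)

@[simp] theorem Sq.constr_ee {X : Type*} [AddCommGroup X] [Module ℂ X] (f : Fin 2 → Fin 2 → X)
    (k l : Fin 2) : Sq.constr f (ee k l) = f k l := by
  have h := ((Pi.basisFun ℂ (Fin 2)).tensorProduct (Pi.basisFun ℂ (Fin 2))).constr_basis ℂ
    (fun p => f p.1 p.2) (k, l)
  rw [Module.Basis.tensorProduct_apply, Pi.basisFun_apply, Pi.basisFun_apply] at h
  exact h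

theorem Sq.hom_ext {X : Type*} [AddCommGroup X] [Module ℂ X] {f g : Sq →ₗ[ℂ] X}
    (h : ∀ k l, f (ee k l) = g (ee k l)) : f = g := by
  refine ((Pi.basisFun ℂ (Fin 2)).tensorProduct (Pi.basisFun ℂ (Fin 2))).ext fun p => ?_
  rw [Module.Basis.tensorProduct_apply, Pi.basisFun_apply, Pi.basisFun_apply]
  exact h p.1 p.2

theorem braiding_ee (r : Fin 2 → Fin 2 → Fin 2 → Fin 2 → ℂ) (k l : Fin 2) :
    braiding r (ee k l) = ∑ m, ∑ n, r m k n l • ee n m := braiding_single r k l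

theorem ofMatrix_tensor_ee {C : Type*} [Ring C] [Bialgebra ℂ C] (t : Fin 2 → Fin 2 → C) (h₁) (h₂)
    (k l : Fin 2) :
    ((RightComodule.ofMatrix t h₁ h₂).tensor (RightComodule.ofMatrix t h₁ h₂)).coact (ee k l)
      = ∑ m, ∑ n, ee m n ⊗ₜ[ℂ] (t m k * t n l) := by
  simp only [ee, tensor_coact_tmul, ofMatrix_single, TensorProduct.sum_tmul,
    TensorProduct.tmul_sum, map_sum, TensorProduct.tensorTensorTensorComm_tmul,
    LinearMap.lTensor_tmul, LinearMap.mul'_apply]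
  exact Finset.sum_comm

/-! ### Low degrees of the quantum plane as the symmetric and alternating quotients of ℂ² ⊗ ℂ². -/

namespace QPlane

variable (lam : ℂ)

theorem gen_mul_gen_mem (k l : Fin 2) : gen lam k * gen lam l ∈ deg lam 2 := by
  rw [deg, pow_two]
  exact Submodule.mul_mem_mul (Submodule.subset_span ⟨k, rfl⟩) (Submodule.subset_span ⟨l, rfl⟩)

theorem one_mem_deg_zero : (1 : QPlane lam) ∈ deg lam 0 := by
  rw [deg, pow_zero]
  exact Submodule.one_le.1 le_rfl

/-- The multiplication map from `ℂ² ⊗ ℂ²` onto the polynomials of degree two. -/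
def mulSq : Sq →ₗ[ℂ] deg lam 2 :=
  Sq.constr fun k l => ⟨gen lam k * gen lam l, gen_mul_gen_mem lam k l⟩

/-- The coefficients of the invariant form `e_0 ⊗ e_1 ↦ 1`, `e_1 ⊗ e_0 ↦ -lam`. -/
def eps (k l : Fin 2) : ℂ := if k = l then 0 else if k = 0 then 1 else -lam

/-- The invariant form on `ℂ² ⊗ ℂ²`, with values in the polynomials of degree zero. -/
def formSq : Sq →ₗ[ℂ] deg lam 0 :=
  Sq.constr fun k l => eps lam k l • ⟨1, one_mem_deg_zero lam⟩

/-- A representation of the quantum plane on `ℂ³` by strictly upper triangular matrices. -/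
def rep (u v : ℂ) : QPlane lam →ₐ[ℂ] Matrix (Fin 3) (Fin 3) ℂ :=
  lift lam ![!![0, lam * u, 0; 0, 0, u; 0, 0, 0], !![0, v, 0; 0, 0, v; 0, 0, 0]] (by
    ext i j
    fin_cases i <;> fin_cases j <;> simp [Matrix.mul_apply, Fin.sum_univ_three]
    ring)

/-- A linear form on the quantum plane with `x² ↦ lam u²`, `y x ↦ u v`, `y² ↦ v²`. -/
def repForm (u v : ℂ) : QPlane lam →ₗ[ℂ] ℂ :=
  Matrix.entryLinearMap ℂ ℂ 0 2 ∘ₗ (rep lam u v).toLinearMap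

/-- These forms separate x², yx and y². They replace a monomial basis of the quantum plane, whose
linear independence is not immediate from the presentation. -/
theorem repForm_gen_mul_gen (u v : ℂ) (k l : Fin 2) :
    repForm lam u v (gen lam k * gen lam l) = ![lam * u, v] k * ![u, v] l := by
  fin_cases k <;> fin_cases l <;>
    simp [repForm, rep, Matrix.mul_apply, Fin.sum_univ_three]

/-- The character of the quantum plane that vanishes on the generators. -/
def character : QPlane lam →ₐ[ℂ] ℂ := lift lam 0 (by simp)

/-- The `q`-symmetric section of the multiplication map. -/
def symSq : deg lam 2 →ₗ[ℂ] Sq :=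
  ((lam⁻¹ • repForm lam 1 0).smulRight (ee 0 0) +
    -- Polarisation: on x², yx, y² this difference takes the values 0, 1, 0, so it reads off the
    -- coefficient of yx. The vector below multiplies to yx, because lam·xy + yx = (1 + lam²)yx.
    (repForm lam 1 1 - repForm lam 1 0 - repForm lam 0 1).smulRight
      ((1 + lam ^ 2)⁻¹ • (lam • ee 0 1 + ee 1 0)) +
    (repForm lam 0 1).smulRight (ee 1 1)) ∘ₗ (deg lam 2).subtype

/-- The `q`-antisymmetric section of the invariant form. -/
def altSq : deg lam 0 →ₗ[ℂ] Sq :=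
  ((character lam).toLinearMap.smulRight
    ((1 + lam ^ 2)⁻¹ • (ee 0 1 - lam • ee 1 0))) ∘ₗ (deg lam 0).subtype

theorem altSq_formSq_ee (k l : Fin 2) : altSq lam (formSq lam (ee k l)) =
    (eps lam k l * (1 + lam ^ 2)⁻¹) • (ee 0 1 - lam • ee 1 0) := by
  simp [altSq, formSq, smul_smul]

/-- The lone factor `![lam, 1] k` is the value of `repForm lam 1 1`, whose second factor is always
1. -/
theorem symSq_mulSq_ee (k l : Fin 2) : symSq lam (mulSq lam (ee k l)) =
    (lam⁻¹ * (![lam, 0] k * ![1, 0] l)) • ee 0 0 +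
    (![lam, 1] k - ![lam, 0] k * ![1, 0] l - ![0, 1] k * ![0, 1] l) •
      ((1 + lam ^ 2)⁻¹ • (lam • ee 0 1 + ee 1 0)) + (![0, 1] k * ![0, 1] l) • ee 1 1 := by
  fin_cases k <;> fin_cases l <;> simp [symSq, mulSq, repForm_gen_mul_gen]

variable {lam}

theorem symSq_mulSq (h0 : lam ≠ 0) (h1 : 1 + lam ^ 2 ≠ 0) :
    symSq lam ∘ₗ mulSq lam + altSq lam ∘ₗ formSq lam = LinearMap.id := by
  refine Sq.hom_ext fun k l => ?_
  rw [LinearMap.add_apply, LinearMap.comp_apply, LinearMap.comp_apply, symSq_mulSq_ee,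
    altSq_formSq_ee]
  fin_cases k <;> fin_cases l <;> simp [eps, h0, smul_smul]
  all_goals
    match_scalars <;> field_simp <;> ring

/-- The alternating vector e₀ ⊗ e₁ - lam·e₁ ⊗ e₀ multiplies to the defining relation of the plane.
-/
theorem mulSq_altSq : mulSq lam ∘ₗ altSq lam = 0 := by
  ext p
  simp [mulSq, altSq, xy]

theorem formSq_symSq : formSq lam ∘ₗ symSq lam = 0 := by
  ext p
  simp only [formSq, symSq, eps, LinearMap.comp_apply, LinearMap.add_apply,
    LinearMap.smulRight_apply, map_add, map_smul, Sq.constr_ee]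
  simp [smul_smul, mul_assoc]

theorem formSq_altSq (h1 : 1 + lam ^ 2 ≠ 0) : formSq lam ∘ₗ altSq lam = LinearMap.id := by
  ext p
  obtain ⟨p, hp⟩ := p
  have hp' := hp
  rw [deg, pow_zero] at hp'
  -- Degree zero consists of the scalars, on which `character` returns the scalar itself; the form
  -- takes the value 1 + lam² on the alternating vector.
  obtain ⟨r, rfl⟩ := Submodule.mem_one.1 hp'
  simp only [altSq, formSq, eps, LinearMap.comp_apply, LinearMap.smulRight_apply, map_smul,
    map_sub, Sq.constr_ee, Submodule.subtype_apply, AlgHom.toLinearMap_apply, AlgHom.commutes,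
    LinearMap.id_apply]
  simp [smul_smul, ← add_smul, Algebra.algebraMap_eq_smul_one, ← sub_smul]
  congr 1
  field_simp

theorem range_mulSq : LinearMap.range (mulSq lam) = ⊤ := by
  have h : (LinearMap.range (mulSq lam)).map (deg lam 2).subtype = deg lam 2 := by
    -- Surjectivity is checked inside the whole plane, where degree two is the span of the products
    -- of two generators.
    refine le_antisymm (Submodule.map_subtype_le _ _) ?_
    rw [← LinearMap.range_comp]
    refine (pow_two (Submodule.span ℂ (Set.range (gen lam)))).le.trans ?_
    rw [Submodule.span_mul_span, Submodule.span_le]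
    rintro _ ⟨_, ⟨k, rfl⟩, _, ⟨l, rfl⟩, rfl⟩
    exact ⟨ee k l, by simp [mulSq]⟩
  refine Submodule.map_injective_of_injective (deg lam 2).injective_subtype ?_
  rw [h, Submodule.map_top, Submodule.range_subtype]

/-- Composing `symSq_mulSq` with multiplication, which kills the alternating part, gives μsμ = μ;
surjectivity of μ cancels it on the right. Thus no basis of the quadratic polynomials is required.
-/
theorem mulSq_symSq (h0 : lam ≠ 0) (h1 : 1 + lam ^ 2 ≠ 0) :
    mulSq lam ∘ₗ symSq lam = LinearMap.id := by
  refine (LinearMap.cancel_right (LinearMap.range_eq_top.1 range_mulSq)).1 ?_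
  have h := congrArg (mulSq lam ∘ₗ ·) (symSq_mulSq h0 h1)
  simpa only [LinearMap.comp_add, ← LinearMap.comp_assoc, mulSq_altSq, LinearMap.zero_comp,
    add_zero, LinearMap.comp_id, LinearMap.id_comp] using h

instance : Module.Finite ℂ (deg lam 2) := Module.Finite.of_surjective (mulSq lam)
  (LinearMap.range_eq_top.1 range_mulSq)

theorem finrank_deg_zero : Module.finrank ℂ (deg lam 0) = 1 := by
  rw [finrank_eq_one_iff_of_nonzero' (⟨1, one_mem_deg_zero lam⟩ : deg lam 0)]
  · rintro ⟨p, hp⟩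
    have hp' := hp
    rw [deg, pow_zero] at hp'
    obtain ⟨r, rfl⟩ := Submodule.mem_one.1 hp'
    exact ⟨r, Subtype.ext (Algebra.algebraMap_eq_smul_one r).symm⟩
  -- The constant 1 is nonzero in the plane because a character takes the value 1 on it.
  · intro h
    have := congrArg (fun p : deg lam 0 => character lam p) h
    simp at this

instance : Module.Finite ℂ (deg lam 0) :=
  Module.finite_of_finrank_pos (by rw [finrank_deg_zero]; exact one_pos)

/-- The dimension comes by subtraction: ℂ² ⊗ ℂ² has dimension 4 and splits off the line of
constants. -/
theorem finrank_deg_two (h0 : lam ≠ 0) (h1 : 1 + lam ^ 2 ≠ 0) :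
    Module.finrank ℂ (deg lam 2) = 3 := by
  have e : Sq ≃ₗ[ℂ] deg lam 2 × deg lam 0 :=
    LinearEquiv.ofLinearMap ((mulSq lam).prod (formSq lam)) ((symSq lam).coprod (altSq lam))
      (by
        rw [LinearMap.prod_comp, LinearMap.comp_coprod, LinearMap.comp_coprod, mulSq_altSq,
          formSq_symSq, mulSq_symSq h0 h1, formSq_altSq h1]
        ext <;> simp)
      (by rw [LinearMap.coprod_comp_prod, symSq_mulSq h0 h1])
  have h := e.finrank_eq
  rw [Module.finrank_prod, finrank_deg_zero, Module.finrank_tensorProduct] at h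
  simp at h
  omega

variable {C : Type*} [Ring C] [Bialgebra ℂ C]

theorem mulSq_colinear (t : Fin 2 → Fin 2 → C) (h₁) (h₂) (h₃) :
    IsColinear ((RightComodule.ofMatrix t h₁ h₂).tensor (RightComodule.ofMatrix t h₁ h₂))
      ((comodule lam t h₁ h₂ h₃).sub _ (comodule_isSub lam t h₁ h₂ h₃ 2)) (mulSq lam) := by
  refine IsColinear.of_subtype_comp _ (Sq.hom_ext fun k l => ?_)
  have e := lift_gen lam (fun k => ∑ m, gen lam m ⊗ₜ[ℂ] t m k) h₃
  rw [LinearMap.comp_apply, LinearMap.comp_apply, LinearMap.comp_apply _ (_ : Sq →ₗ[ℂ] _),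
    ofMatrix_tensor_ee]
  simp only [mulSq, LinearMap.comp_apply, Sq.constr_ee, Submodule.subtype_apply, map_sum,
    LinearMap.rTensor_tmul]
  -- The coaction on the plane is an algebra map, so on x_k x_l it is the product of the coactions
  -- of the generators, which is what the tensor coaction yields after multiplication.
  rw [ComoduleAlgebra.coact_mul]
  refine (congrArg₂ (· * ·) (e k) (e l)).trans ?_
  simp [mul_add, add_mul]
  abel

/-- The hypothesis `h` says that the form is invariant under t, so that it maps to the trivial
comodule of constants. -/
theorem formSq_colinear (t : Fin 2 → Fin 2 → C) (h₁) (h₂) (h₃)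
    (h : ∀ k l, ∑ m, ∑ n, eps lam m n • (t m k * t n l) = eps lam k l • 1) :
    IsColinear ((RightComodule.ofMatrix t h₁ h₂).tensor (RightComodule.ofMatrix t h₁ h₂))
      ((comodule lam t h₁ h₂ h₃).sub _ (comodule_isSub lam t h₁ h₂ h₃ 0)) (formSq lam) := by
  refine IsColinear.of_subtype_comp _ (Sq.hom_ext fun k l => ?_)
  rw [LinearMap.comp_apply, LinearMap.comp_apply, LinearMap.comp_apply _ (_ : Sq →ₗ[ℂ] _),
    ofMatrix_tensor_ee]
  simp only [formSq, LinearMap.comp_apply, Sq.constr_ee, Submodule.subtype_apply, map_sum,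
    LinearMap.rTensor_tmul, map_smul, Submodule.coe_smul, ComoduleAlgebra.coact_one]
  simp only [← TensorProduct.smul_tmul', ← TensorProduct.tmul_smul, ← TensorProduct.tmul_sum, h]
  rw [TensorProduct.tmul_smul, Algebra.TensorProduct.one_def]

end QPlane

/-- Complementary projections `μ`, `ε` with sections `s`, `a` whose ranges are eigenspaces of `Ψ`
for the eigenvalues `α`, `β`. -/
structure EigenSplit {T Y Z : Type*} [AddCommGroup T] [Module ℂ T] [AddCommGroup Y] [Module ℂ Y]
    [AddCommGroup Z] [Module ℂ Z] (Ψ : T →ₗ[ℂ] T) (μ : T →ₗ[ℂ] Y) (ε : T →ₗ[ℂ] Z)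
    (s : Y →ₗ[ℂ] T) (a : Z →ₗ[ℂ] T) (α β : ℂ) : Prop where
  id : s ∘ₗ μ + a ∘ₗ ε = LinearMap.id
  μs : μ ∘ₗ s = LinearMap.id
  εs : ε ∘ₗ s = 0
  εa : ε ∘ₗ a = LinearMap.id
  μa : μ ∘ₗ a = 0
  μΨ : μ ∘ₗ Ψ = α • μ
  εΨ : ε ∘ₗ Ψ = β • ε

namespace EigenSplit

variable {T Y Z : Type*} [AddCommGroup T] [Module ℂ T] [AddCommGroup Y] [Module ℂ Y]
    [AddCommGroup Z] [Module ℂ Z] {Ψ : T →ₗ[ℂ] T} {μ : T →ₗ[ℂ] Y} {ε : T →ₗ[ℂ] Z}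
    {s : Y →ₗ[ℂ] T} {a : Z →ₗ[ℂ] T} {α β : ℂ}

/-- Resolving the identity in front gives Ψs = sμΨs + aεΨs = α·sμs + β·aεs, and εs = 0. So the
eigenvalue equations need checking only on the projections, which are easier to evaluate on basis
vectors. -/
theorem Ψs (h : EigenSplit Ψ μ ε s a α β) : Ψ ∘ₗ s = α • s := by
  rw [← LinearMap.id_comp (Ψ ∘ₗ s), ← h.id, LinearMap.add_comp, LinearMap.comp_assoc,
    LinearMap.comp_assoc, ← LinearMap.comp_assoc _ Ψ μ, ← LinearMap.comp_assoc _ Ψ ε, h.μΨ, h.εΨ,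
    LinearMap.smul_comp, LinearMap.smul_comp, h.μs, h.εs]
  simp [LinearMap.comp_smul]

theorem Ψa (h : EigenSplit Ψ μ ε s a α β) : Ψ ∘ₗ a = β • a := by
  rw [← LinearMap.id_comp (Ψ ∘ₗ a), ← h.id, LinearMap.add_comp, LinearMap.comp_assoc,
    LinearMap.comp_assoc, ← LinearMap.comp_assoc _ Ψ μ, ← LinearMap.comp_assoc _ Ψ ε, h.μΨ, h.εΨ,
    LinearMap.smul_comp, LinearMap.smul_comp, h.μa, h.εa]
  simp [LinearMap.comp_smul]

end EigenSplit

/-! ### The two braidings: eigenvalues, and colinearity of multiplication and form. -/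

variable (q : Param)

/-- Here the reality of q enters: for a complex parameter ±i the symmetric and alternating parts
would meet. -/
theorem one_add_qc_sq_ne_zero : 1 + qc q ^ 2 ≠ 0 := by
  have h : (1 + (q : ℝ) ^ 2 : ℝ) ≠ 0 := by positivity
  unfold qc
  exact_mod_cast h

theorem one_add_inv_qc_sq_ne_zero : 1 + (qc q)⁻¹ ^ 2 ≠ 0 := by
  have h : (1 + (q : ℝ)⁻¹ ^ 2 : ℝ) ≠ 0 := by positivity
  unfold qc
  exact_mod_cast h

theorem zeta_sq : zeta q ^ 2 = (qc q)⁻¹ := by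
  have h : ((Real.sqrt (q : ℝ))⁻¹) ^ 2 = (q : ℝ)⁻¹ := by
    rw [inv_pow, Real.sq_sqrt q.2.1.le]
  unfold zeta qc
  exact_mod_cast h

/-- Up to the factor ζ this is the Hecke property of the R-matrix, with eigenvalues q and -q⁻¹. For
example x ⊗ y goes to ζ(yx + (q - q⁻¹)xy) = ζq·xy, as yx = q⁻¹xy. -/
theorem Psi_eigenSplit : EigenSplit (Psi q) (QPlane.mulSq (qc q)) (QPlane.formSq (qc q))
    (QPlane.symSq (qc q)) (QPlane.altSq (qc q)) (zeta q * qc q) (-(zeta q * (qc q)⁻¹)) where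
  id := QPlane.symSq_mulSq (qc_ne_zero q) (one_add_qc_sq_ne_zero q)
  μs := QPlane.mulSq_symSq (qc_ne_zero q) (one_add_qc_sq_ne_zero q)
  εs := QPlane.formSq_symSq
  εa := QPlane.formSq_altSq (one_add_qc_sq_ne_zero q)
  μa := QPlane.mulSq_altSq
  μΨ := by
    have hq := qc_ne_zero q
    refine Sq.hom_ext fun k l => Subtype.ext ?_
    rw [LinearMap.comp_apply, Psi, braiding_ee]
    simp only [map_sum, map_smul, QPlane.mulSq, Sq.constr_ee, LinearMap.smul_apply]
    fin_cases k <;> fin_cases l <;>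
    simp [Rmat, QPlane.xy, smul_smul] <;> (match_scalars <;> field_simp <;> try ring)
  εΨ := by
    have hq := qc_ne_zero q
    refine Sq.hom_ext fun k l => Subtype.ext ?_
    rw [LinearMap.comp_apply, Psi, braiding_ee]
    simp only [map_sum, map_smul, QPlane.formSq, Sq.constr_ee, LinearMap.smul_apply]
    fin_cases k <;> fin_cases l <;>
    simp [Rmat, QPlane.eps, smul_smul] <;> (match_scalars <;> field_simp <;> try ring)

theorem PsiCop_eigenSplit : EigenSplit (PsiCop q) (QPlane.mulSq (qc q)⁻¹)
    (QPlane.formSq (qc q)⁻¹) (QPlane.symSq (qc q)⁻¹) (QPlane.altSq (qc q)⁻¹)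
    (zeta q * qc q) (-(zeta q * (qc q)⁻¹)) where
  id := QPlane.symSq_mulSq (inv_ne_zero (qc_ne_zero q)) (one_add_inv_qc_sq_ne_zero q)
  μs := QPlane.mulSq_symSq (inv_ne_zero (qc_ne_zero q)) (one_add_inv_qc_sq_ne_zero q)
  εs := QPlane.formSq_symSq
  εa := QPlane.formSq_altSq (one_add_inv_qc_sq_ne_zero q)
  μa := QPlane.mulSq_altSq
  μΨ := by
    have hq := qc_ne_zero q
    refine Sq.hom_ext fun k l => Subtype.ext ?_
    rw [LinearMap.comp_apply, PsiCop, braiding_ee]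
    simp only [map_sum, map_smul, QPlane.mulSq, Sq.constr_ee, LinearMap.smul_apply]
    fin_cases k <;> fin_cases l <;>
    simp [Rmat, QPlane.xy, smul_smul] <;> (match_scalars <;> field_simp <;> try ring)
  εΨ := by
    have hq := qc_ne_zero q
    refine Sq.hom_ext fun k l => Subtype.ext ?_
    rw [LinearMap.comp_apply, PsiCop, braiding_ee]
    simp only [map_sum, map_smul, QPlane.formSq, Sq.constr_ee, LinearMap.smul_apply]
    fin_cases k <;> fin_cases l <;>
    simp [Rmat, QPlane.eps, smul_smul] <;> (match_scalars <;> field_simp <;> try ring)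

theorem mulSq_colinear_V :
    IsColinear ((Vhalf q).tensor (Vhalf q)) (V q 2) (QPlane.mulSq (qc q)) :=
  QPlane.mulSq_colinear _ _ _ _

theorem mulSq_colinear_Vcop :
    IsColinear ((VhalfCop q).tensor (VhalfCop q)) (Vcop q 2) (QPlane.mulSq (qc q)⁻¹) :=
  QPlane.mulSq_colinear _ _ _ _

/-- Invariance of the form amounts to the relation that the quantum determinant is 1, along with the
commutation relations within each row and column. -/
theorem formSq_colinear_V :
    IsColinear ((Vhalf q).tensor (Vhalf q)) (V q 0) (QPlane.formSq (qc q)) := by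
  refine QPlane.formSq_colinear _ _ _ _ fun k l => ?_
  have hq := qc_ne_zero q
  fin_cases k <;> fin_cases l <;>
  simp [QPlane.eps, SU.ba, SU.ca, SU.db, SU.dc, SU.cb, SU.ad, SU.da, smul_smul] <;>
  (match_scalars <;> field_simp <;> try ring)

theorem formSq_colinear_Vcop :
    IsColinear ((VhalfCop q).tensor (VhalfCop q)) (Vcop q 0) (QPlane.formSq (qc q)⁻¹) := by
  refine QPlane.formSq_colinear _ _ _ _ fun k l => ?_
  have hq := qc_ne_zero q
  -- The co-opposite bialgebra has the same product, so the identity is verified in `SU q`, where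
  -- the rewriting rules live, and then transported by `SUcop.of`.
  have h : ∑ m, ∑ n, QPlane.eps (qc q)⁻¹ m n • (SU.Sinva q m k * SU.Sinva q n l)
      = QPlane.eps (qc q)⁻¹ k l • 1 := by
    fin_cases k <;> fin_cases l <;>
    simp [SU.Sinva, QPlane.eps, SU.ba, SU.ca, SU.db, SU.dc, SU.cb, SU.ad, SU.da, smul_smul] <;>
    (match_scalars <;> field_simp <;> try ring)
  have h' := congrArg (SUcop.of q) h
  simpa only [tcop, map_sum, map_smul, map_mul, map_one] using h'

/-! ### Mixed eigenvectors of a tensor product of two split operators. -/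

namespace EigenSplit

variable {T Y Z T' Y' Z' : Type*} [AddCommGroup T] [Module ℂ T] [AddCommGroup Y] [Module ℂ Y]
  [AddCommGroup Z] [Module ℂ Z] [AddCommGroup T'] [Module ℂ T'] [AddCommGroup Y'] [Module ℂ Y']
  [AddCommGroup Z'] [Module ℂ Z'] {Ψ : T →ₗ[ℂ] T} {μ : T →ₗ[ℂ] Y} {ε : T →ₗ[ℂ] Z}
  {s : Y →ₗ[ℂ] T} {a : Z →ₗ[ℂ] T} {Ψ' : T' →ₗ[ℂ] T'} {μ' : T' →ₗ[ℂ] Y'} {ε' : T' →ₗ[ℂ] Z'}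
  {s' : Y' →ₗ[ℂ] T'} {a' : Z' →ₗ[ℂ] T'} {α β : ℂ}

/-- An eigenvector of `Ψ' ⊗ Ψ` for the mixed eigenvalue is the sum of its mixed components. -/
theorem map_apply_eq_self (h' : EigenSplit Ψ' μ' ε' s' a' α β) (h : EigenSplit Ψ μ ε s a α β)
    (hα : α * α ≠ α * β) (hβ : β * β ≠ α * β) {w : T' ⊗[ℂ] T}
    (hw : TensorProduct.map Ψ' Ψ w = (α * β) • w) :
    TensorProduct.map s' a (TensorProduct.map μ' ε w)
      + TensorProduct.map a' s (TensorProduct.map ε' μ w) = w := by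
  -- Applying μ' ⊗ μ to the eigenvalue equation multiplies this component by α² on one side and by
  -- αβ on the other. The component for ε' ⊗ ε is treated alike, with β².
  have hμ : TensorProduct.map μ' μ w = 0 := by
    have e := congrArg (TensorProduct.map μ' μ) hw
    rw [← LinearMap.comp_apply, ← TensorProduct.map_comp, h'.μΨ, h.μΨ, map_smul,
      TensorProduct.map_smul_left, TensorProduct.map_smul_right, smul_smul, LinearMap.smul_apply,
      ← sub_eq_zero, ← sub_smul] at e
    exact (smul_eq_zero.1 e).resolve_left (sub_ne_zero.2 hα)
  have hε : TensorProduct.map ε' ε w = 0 := by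
    have e := congrArg (TensorProduct.map ε' ε) hw
    rw [← LinearMap.comp_apply, ← TensorProduct.map_comp, h'.εΨ, h.εΨ, map_smul,
      TensorProduct.map_smul_left, TensorProduct.map_smul_right, smul_smul, LinearMap.smul_apply,
      ← sub_eq_zero, ← sub_smul] at e
    exact (smul_eq_zero.1 e).resolve_left (sub_ne_zero.2 hβ)
  -- Expanding the product of the two resolutions of the identity gives four terms; the two unmixed
  -- ones vanish.
  have e : TensorProduct.map (s' ∘ₗ μ' + a' ∘ₗ ε') (s ∘ₗ μ + a ∘ₗ ε) w = w := by
    rw [h'.id, h.id, TensorProduct.map_id, LinearMap.id_apply]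
  simpa only [TensorProduct.map_add_left, TensorProduct.map_add_right, LinearMap.add_apply,
    TensorProduct.map_comp, LinearMap.comp_apply, hμ, hε, map_zero, zero_add, add_zero, add_comm] using e

end EigenSplit

/-- The reordering `W ⊗ W ≃ (Ṽ_{1/2} ⊗ Ṽ_{1/2}) ⊗ (V_{1/2} ⊗ V_{1/2})`. -/
def shuffle : WSpace ⊗[ℂ] WSpace ≃ₗ[ℂ] Sq ⊗[ℂ] Sq :=
  TensorProduct.tensorTensorTensorComm ℂ _ _ _ _

/-- The middle flip is its own inverse, so the outer flip in `Phi` is `shuffle.symm`, and reordering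
turns `Phi` into `PsiCop` ⊗ `Psi`. -/
theorem shuffle_Phi (z : WSpace ⊗[ℂ] WSpace) :
    shuffle (Phi q z) = TensorProduct.map (PsiCop q) (Psi q) (shuffle z) :=
  shuffle.apply_symm_apply _

theorem Phi_shuffle_symm (w : Sq ⊗[ℂ] Sq) :
    Phi q (shuffle.symm w) = shuffle.symm (TensorProduct.map (PsiCop q) (Psi q) w) := by
  apply shuffle.injective
  rw [shuffle_Phi, LinearEquiv.apply_symm_apply, LinearEquiv.apply_symm_apply]

/-- This identifies the eigenvalue defining `Lambda2Space` with the mixed product αβ; the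
normalisation ζ² = q⁻¹ is what makes it fit. -/
theorem eigenvalue_mul : zeta q * qc q * (-(zeta q * (qc q)⁻¹)) = -(qc q)⁻¹ := by
  have hq := qc_ne_zero q
  have h : zeta q * qc q * (-(zeta q * (qc q)⁻¹)) = -(zeta q ^ 2) := by field_simp
  rw [h, zeta_sq]

/-- Equality would force q² = -1. With α and β nonzero, α ≠ β separates αβ from α² and from β². -/
theorem eigenvalues_ne : zeta q * qc q ≠ -(zeta q * (qc q)⁻¹) := by
  intro h
  have hq := qc_ne_zero q
  have hz : zeta q ≠ 0 := fun h0 => inv_ne_zero hq (by rw [← zeta_sq, h0]; simp)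
  apply one_add_qc_sq_ne_zero q
  field_simp at h
  linear_combination h

theorem sym_eigenvalue_ne : zeta q * qc q ≠ 0 := fun h =>
  neg_ne_zero.2 (inv_ne_zero (qc_ne_zero q)) (by rw [← eigenvalue_mul, h, zero_mul])

theorem alt_eigenvalue_ne : -(zeta q * (qc q)⁻¹) ≠ 0 := fun h =>
  neg_ne_zero.2 (inv_ne_zero (qc_ne_zero q)) (by rw [← eigenvalue_mul, h, mul_zero])

/-! ### The linear splitting of the antisymmetric tensors and their dimension. -/

theorem mem_Lambda2Space {z : WSpace ⊗[ℂ] WSpace} :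
    z ∈ Lambda2Space q ↔ Phi q z = (-(qc q)⁻¹) • z :=
  Module.End.mem_eigenspace_iff

/-- The projection of the `q`-antisymmetric tensors onto the self-dual part. -/
def thetaPlus : Lambda2Space q →ₗ[ℂ] SpinSpace q 2 0 :=
  TensorProduct.map (QPlane.mulSq (qc q)⁻¹) (QPlane.formSq (qc q)) ∘ₗ
    shuffle.toLinearMap ∘ₗ (Lambda2Space q).subtype

/-- The projection of the `q`-antisymmetric tensors onto the anti-self-dual part. -/
def thetaMinus : Lambda2Space q →ₗ[ℂ] SpinSpace q 0 2 :=
  TensorProduct.map (QPlane.formSq (qc q)⁻¹) (QPlane.mulSq (qc q)) ∘ₗ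
    shuffle.toLinearMap ∘ₗ (Lambda2Space q).subtype

/-- The inclusion of the self-dual part into the `q`-antisymmetric tensors. -/
def iotaPlus : SpinSpace q 2 0 →ₗ[ℂ] Lambda2Space q :=
  (shuffle.symm.toLinearMap ∘ₗ
    TensorProduct.map (QPlane.symSq (qc q)⁻¹) (QPlane.altSq (qc q))).codRestrict _ (by
    intro v
    -- The section lands in the eigenspace because its left factor consists of α-eigenvectors and
    -- its right factor of β-eigenvectors.
    rw [mem_Lambda2Space, LinearMap.comp_apply, LinearEquiv.coe_coe, Phi_shuffle_symm,
      ← LinearMap.comp_apply, ← TensorProduct.map_comp, (PsiCop_eigenSplit q).Ψs,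
      (Psi_eigenSplit q).Ψa, TensorProduct.map_smul_left, TensorProduct.map_smul_right, smul_smul,
      eigenvalue_mul, LinearMap.smul_apply, map_smul])

/-- The inclusion of the anti-self-dual part into the `q`-antisymmetric tensors. -/
def iotaMinus : SpinSpace q 0 2 →ₗ[ℂ] Lambda2Space q :=
  (shuffle.symm.toLinearMap ∘ₗ
    TensorProduct.map (QPlane.altSq (qc q)⁻¹) (QPlane.symSq (qc q))).codRestrict _ (by
    intro v
    rw [mem_Lambda2Space, LinearMap.comp_apply, LinearEquiv.coe_coe, Phi_shuffle_symm,
      ← LinearMap.comp_apply, ← TensorProduct.map_comp, (PsiCop_eigenSplit q).Ψa,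
      (Psi_eigenSplit q).Ψs, TensorProduct.map_smul_left, TensorProduct.map_smul_right, smul_smul,
      mul_comm, eigenvalue_mul, LinearMap.smul_apply, map_smul])

theorem iota_theta :
    iotaPlus q ∘ₗ thetaPlus q + iotaMinus q ∘ₗ thetaMinus q = LinearMap.id := by
  refine LinearMap.ext fun z => Subtype.ext (shuffle.injective ?_)
  have hz := (mem_Lambda2Space q).1 z.2
  have hw : TensorProduct.map (PsiCop q) (Psi q) (shuffle (z : WSpace ⊗[ℂ] WSpace))
      = (zeta q * qc q * (-(zeta q * (qc q)⁻¹))) • shuffle (z : WSpace ⊗[ℂ] WSpace) := by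
    rw [← shuffle_Phi, hz, map_smul, eigenvalue_mul]
  -- The side conditions α² ≠ αβ and β² ≠ αβ reduce to α ≠ β by cancelling α, respectively β.
  refine Eq.trans ?_ ((PsiCop_eigenSplit q).map_apply_eq_self (Psi_eigenSplit q)
    (fun h => eigenvalues_ne q (mul_left_cancel₀ (sym_eigenvalue_ne q) h))
    (fun h => eigenvalues_ne q (mul_right_cancel₀ (alt_eigenvalue_ne q) h).symm) hw)
  change shuffle (shuffle.symm _ + shuffle.symm _) = _
  rw [map_add, LinearEquiv.apply_symm_apply, LinearEquiv.apply_symm_apply]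
  rfl

theorem shuffle_iotaPlus (v : SpinSpace q 2 0) :
    shuffle (iotaPlus q v : WSpace ⊗[ℂ] WSpace)
      = TensorProduct.map (QPlane.symSq (qc q)⁻¹) (QPlane.altSq (qc q)) v :=
  shuffle.apply_symm_apply _

theorem shuffle_iotaMinus (v : SpinSpace q 0 2) :
    shuffle (iotaMinus q v : WSpace ⊗[ℂ] WSpace)
      = TensorProduct.map (QPlane.altSq (qc q)⁻¹) (QPlane.symSq (qc q)) v :=
  shuffle.apply_symm_apply _

theorem thetaPlus_apply (z : Lambda2Space q) : thetaPlus q z =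
    TensorProduct.map (QPlane.mulSq (qc q)⁻¹) (QPlane.formSq (qc q))
      (shuffle (z : WSpace ⊗[ℂ] WSpace)) := rfl

theorem thetaMinus_apply (z : Lambda2Space q) : thetaMinus q z =
    TensorProduct.map (QPlane.formSq (qc q)⁻¹) (QPlane.mulSq (qc q))
      (shuffle (z : WSpace ⊗[ℂ] WSpace)) := rfl

theorem thetaPlus_iotaPlus : thetaPlus q ∘ₗ iotaPlus q = LinearMap.id := by
  refine LinearMap.ext fun v => ?_
  rw [LinearMap.comp_apply, thetaPlus_apply, shuffle_iotaPlus, ← LinearMap.comp_apply,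
    ← TensorProduct.map_comp, (PsiCop_eigenSplit q).μs, (Psi_eigenSplit q).εa,
    TensorProduct.map_id]

theorem thetaMinus_iotaPlus : thetaMinus q ∘ₗ iotaPlus q = 0 := by
  refine LinearMap.ext fun v => ?_
  rw [LinearMap.comp_apply, thetaMinus_apply, shuffle_iotaPlus, ← LinearMap.comp_apply,
    ← TensorProduct.map_comp, (PsiCop_eigenSplit q).εs, TensorProduct.map_zero_left]

theorem thetaMinus_iotaMinus : thetaMinus q ∘ₗ iotaMinus q = LinearMap.id := by
  refine LinearMap.ext fun v => ?_
  rw [LinearMap.comp_apply, thetaMinus_apply, shuffle_iotaMinus, ← LinearMap.comp_apply,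
    ← TensorProduct.map_comp, (PsiCop_eigenSplit q).εa, (Psi_eigenSplit q).μs,
    TensorProduct.map_id]

theorem thetaPlus_iotaMinus : thetaPlus q ∘ₗ iotaMinus q = 0 := by
  refine LinearMap.ext fun v => ?_
  rw [LinearMap.comp_apply, thetaPlus_apply, shuffle_iotaMinus, ← LinearMap.comp_apply,
    ← TensorProduct.map_comp, (PsiCop_eigenSplit q).μa, TensorProduct.map_zero_left]

/-- The splitting of the `q`-antisymmetric tensors into self-dual and anti-self-dual part. -/
def thetaEquiv : Lambda2Space q ≃ₗ[ℂ] SpinSpace q 2 0 × SpinSpace q 0 2 :=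
  LinearEquiv.ofLinearMap ((thetaPlus q).prod (thetaMinus q))
    ((iotaPlus q).coprod (iotaMinus q))
    (by
      rw [LinearMap.prod_comp, LinearMap.comp_coprod, LinearMap.comp_coprod, thetaPlus_iotaPlus,
        thetaPlus_iotaMinus, thetaMinus_iotaPlus, thetaMinus_iotaMinus]
      refine LinearMap.ext fun v => Prod.ext ?_ ?_ <;> simp)
    (by rw [LinearMap.coprod_comp_prod, iota_theta])

theorem finrank_Lambda2Space : Module.finrank ℂ (Lambda2Space q) = 6 := by
  have hq := qc_ne_zero q
  rw [(thetaEquiv q).finrank_eq, Module.finrank_prod, Module.finrank_tensorProduct,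
    Module.finrank_tensorProduct, QPlane.finrank_deg_zero, QPlane.finrank_deg_zero,
    QPlane.finrank_deg_two hq (one_add_qc_sq_ne_zero q),
    QPlane.finrank_deg_two (inv_ne_zero hq) (one_add_inv_qc_sq_ne_zero q)]

/-! ### Colinearity of the splitting. -/

theorem shuffle_subtype_colinear : IsColinear (Lambda2 q)
    (((VhalfCop q).tensor (VhalfCop q)).external ((Vhalf q).tensor (Vhalf q)))
    (shuffle.toLinearMap ∘ₗ (Lambda2Space q).subtype) :=
  (tensor_external (VhalfCop q) (VhalfCop q) (Vhalf q) (Vhalf q)).comp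
    (RightComodule.subtype_colinear ((W q).tensor (W q)) (Lambda2Space q)
      ((Phi_colinear q).isSub_eigenspace _))

theorem thetaPlus_colinear : IsColinear (Lambda2 q) (Spin q 2 0) (thetaPlus q) :=
  ((mulSq_colinear_Vcop q).external (formSq_colinear_V q)).comp (shuffle_subtype_colinear q)

theorem thetaMinus_colinear : IsColinear (Lambda2 q) (Spin q 0 2) (thetaMinus q) :=
  ((formSq_colinear_Vcop q).external (mulSq_colinear_V q)).comp (shuffle_subtype_colinear q)

/-- Colinearity of the explicit sections `symSq` and `altSq` is never computed; it follows from that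
of the two projections. -/
theorem iotaPlus_colinear : IsColinear (Spin q 2 0) (Lambda2 q) (iotaPlus q) :=
  (thetaPlus_colinear q).of_biprod (thetaMinus_colinear q) (iota_theta q) (thetaPlus_iotaPlus q)
    (thetaMinus_iotaPlus q)

theorem iotaMinus_colinear : IsColinear (Spin q 0 2) (Lambda2 q) (iotaMinus q) :=
  (thetaMinus_colinear q).of_biprod (thetaPlus_colinear q)
    ((add_comm _ _).trans (iota_theta q)) (thetaMinus_iotaMinus q) (thetaPlus_iotaMinus q)

/-! ### The splitting of two-forms, for a comodule algebra and for the four-sphere. -/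

theorem assocBundle_splits {P : Type*} [Ring P] [Algebra ℂ P] (δ : ComoduleAlgebra (HH q) P) :
    BimoduleSplits (Y := SpinSpace q 2 0) (Z := SpinSpace q 0 2) δ.coinvariants
      (assocBundle δ (Lambda2 q)) (assocBundle δ (Spin q 2 0)) (assocBundle δ (Spin q 0 2))
      (thetaPlus q) (thetaMinus q) :=
  .of_biprod (assocBundle_isBimodule δ _) (assocBundle_isBimodule δ _)
    (assocBundle_isBimodule δ _) (iota_theta q) (thetaPlus_iotaPlus q) (thetaMinus_iotaPlus q)
    (thetaMinus_iotaMinus q) (thetaPlus_iotaMinus q)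
    (fun _ => lTensor_mem_assocBundle (thetaPlus_colinear q) δ)
    (fun _ => lTensor_mem_assocBundle (thetaMinus_colinear q) δ)
    (fun _ => lTensor_mem_assocBundle (iotaPlus_colinear q) δ)
    (fun _ => lTensor_mem_assocBundle (iotaMinus_colinear q) δ)

theorem S4bundle_isBimodule {X : Type*} [AddCommGroup X] [Module ℂ X]
    (ρ : RightComodule (HH q) X) : IsBimodule (S4 q) (S4bundle q ρ) :=
  (assocBundle_isBimodule (SpFree.comodule q) ρ).map (Sp.mk q)

theorem lTensor_mem_S4bundle {X Y : Type*} [AddCommGroup X] [Module ℂ X] [AddCommGroup Y]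
    [Module ℂ Y] {ρ : RightComodule (HH q) X} {σ : RightComodule (HH q) Y} {θ : X →ₗ[ℂ] Y}
    (h : IsColinear ρ σ θ) : ∀ z ∈ S4bundle q ρ, θ.lTensor (Sp q) z ∈ S4bundle q σ :=
  lTensor_mem_map (fun _ => lTensor_mem_assocBundle h (SpFree.comodule q)) (Sp.mk q)

/-- This is not an instance of `assocBundle_splits`: the bundles here are images of coinvariants
over the free algebra, and no coaction on `Sp q` is involved. The same criterion applies, since
membership passes through the quotient map. -/
theorem Omega2_splits :
    BimoduleSplits (Y := SpinSpace q 2 0) (Z := SpinSpace q 0 2) (S4 q) (Omega2 q)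
      (Omega2Plus q) (Omega2Minus q) (thetaPlus q) (thetaMinus q) :=
  .of_biprod (S4bundle_isBimodule q (Lambda2 q)) (S4bundle_isBimodule q (Spin q 2 0))
    (S4bundle_isBimodule q (Spin q 0 2)) (iota_theta q) (thetaPlus_iotaPlus q)
    (thetaMinus_iotaPlus q) (thetaMinus_iotaMinus q) (thetaPlus_iotaMinus q)
    (lTensor_mem_S4bundle q (thetaPlus_colinear q))
    (lTensor_mem_S4bundle q (thetaMinus_colinear q))
    (lTensor_mem_S4bundle q (iotaPlus_colinear q))
    (lTensor_mem_S4bundle q (iotaMinus_colinear q))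

end QSphere

end

theorem mainTheorem6 (q : QSphere.Param) :
    Module.finrank ℂ (QSphere.Lambda2Space q) = 6 ∧
    ∃ (θp : QSphere.Lambda2Space q →ₗ[ℂ] QSphere.SpinSpace q 2 0)
      (θm : QSphere.Lambda2Space q →ₗ[ℂ] QSphere.SpinSpace q 0 2),
      QSphere.IsColinear (QSphere.Lambda2 q) (QSphere.Spin q 2 0) θp ∧
      QSphere.IsColinear (QSphere.Lambda2 q) (QSphere.Spin q 0 2) θm ∧
      Function.Bijective (θp.prod θm) ∧
      QSphere.BimoduleSplits (Y := QSphere.SpinSpace q 2 0) (Z := QSphere.SpinSpace q 0 2)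
        (QSphere.S4 q) (QSphere.Omega2 q) (QSphere.Omega2Plus q) (QSphere.Omega2Minus q) θp θm ∧
      ∀ (P : Type u) [Ring P] [Algebra ℂ P] (δ : QSphere.ComoduleAlgebra (QSphere.HH q) P),
        QSphere.BimoduleSplits δ.coinvariants
          (QSphere.assocBundle δ (QSphere.Lambda2 q))
          (QSphere.assocBundle δ (QSphere.Spin q 2 0))
          (QSphere.assocBundle δ (QSphere.Spin q 0 2)) θp θm :=
  ⟨QSphere.finrank_Lambda2Space q, QSphere.thetaPlus q, QSphere.thetaMinus q,
    QSphere.thetaPlus_colinear q, QSphere.thetaMinus_colinear q, (QSphere.thetaEquiv q).bijective,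
    QSphere.Omega2_splits q, fun _ _ _ δ => QSphere.assocBundle_splits q δ⟩
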